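/- Let $n=n_k$, $p=p_k$, $m=m_k$ be sequences of natural numbers with $m<n$, all tending to infinity, such that $p/n\to\gamma\in(0,\infty)$ and $m/n\to\xi\in(0,1)$; fix $\lambda>0$ and real $\alpha,\sigma$. For each $k$ consider the linear model $Y=X\beta+\varepsilon$, where $X\in\mathbb{R}^{n\times p}$ has iid standard normal entries; the noise $\varepsilon\in\mathbb{R}^n$ is independent of $X$ with $\mathbb{E}\,\varepsilon=0$ and $\mathrm{Cov}(\varepsilon)=\sigma^2 I_n$; and $\beta\in\mathbb{R}^p$ has iid entries with $\mathbb{E}\beta_i=0$, $\mathrm{Var}(\beta_i)=\alpha^2/p$, and is independent of $(X,\varepsilon)$. Let $L$ be an $m\times n$ matrix with $LL^\top=I_m$, either deterministic or random and independent of $(X,\varepsilon,\beta)$, and let $$\hat\beta_p(\lambda)=\left(X^\top L^\top L X/n+\lambda I_p\right)^{-1}X^\top Y/n$$ be the primal sketched ridge regression estimator. Then the mean squared error $\mathbb{E}\|\hat\beta_p(\lambda)-\beta\|_2^2$ is finite and converges to $$M(\lambda)=\alpha^2\,\frac{\left[(\lambda+\xi-1)^2+\gamma(1-\xi)\right]\theta_2\left(\frac{\gamma}{\xi},\frac{\lambda}{\xi}\right)}{\xi^2}+\gamma\sigma^2\,\frac{\xi\,\theta_1\left(\frac{\gamma}{\xi},\frac{\lambda}{\xi}\right)-(\lambda+\xi-1)\,\theta_2\left(\frac{\gamma}{\xi},\frac{\lambda}{\xi}\right)}{\xi^2},$$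 where $\theta_i(\gamma,\lambda)=\int (x+\lambda)^{-i}\,dF_\gamma(x)$ and $F_\gamma$ is the standard Marchenko–Pastur law with aspect ratio $\gamma$, that is, the probability measure with density $\frac{\sqrt{(b-x)(x-a)}}{2\pi\gamma x}$ on $[a,b]$, $a=(1-\sqrt\gamma)^2$, $b=(1+\sqrt\gamma)^2$, together with an atom of mass $1-1/\gamma$ at $0$ if $\gamma>1$. Moreover, the first term of $M(\lambda)$ is the limit of the squared bias $\mathbb{E}\left\|\left(X^\top L^\top LX/n+\lambda I_p\right)^{-1}X^\top X\beta/n-\beta\right\|_2^2$, and the second term is the limit of the variance $\mathbb{E}\left\|\left(X^\top L^\top LX/n+\lambda I_p\right)^{-1}X^\top\varepsilon/n\right\|_2^2$, both of which are finite. -/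

import Mathlib

open MeasureTheory ProbabilityTheory Filter
open scoped Topology Matrix

noncomputable section

/-- The standard Marchenko–Pastur law with aspect ratio `γ > 0` (and unit variance): with
`a = (1 - √γ)²` and `b = (1 + √γ)²`, it has density `√((b - x)(x - a)) / (2 π γ x)` on `[a, b]`
and, when `γ > 1`, an additional atom of mass `1 - 1/γ` at `0`. -/
def marchenkoPastur (γ : ℝ) : Measure ℝ :=
  ENNReal.ofReal (1 - 1 / γ) • Measure.dirac 0 +
    (volume.restrict (Set.Icc ((1 - √γ) ^ 2) ((1 + √γ) ^ 2))).withDensity fun x =>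
      ENNReal.ofReal
        (√(((1 + √γ) ^ 2 - x) * (x - (1 - √γ) ^ 2)) / (2 * Real.pi * γ * x))

/-- `θ_i(γ, lam) = ∫ (x + lam)^{-i} dF_γ(x)`, where `F_γ` is the Marchenko–Pastur law. -/
def mpTheta (i : ℕ) (γ lam : ℝ) : ℝ :=
  ∫ x, ((x + lam) ^ i)⁻¹ ∂(marchenkoPastur γ)

/-- The primal sketched ridge regression estimator
`(Xᵀ Lᵀ L X / n + lam I_p)⁻¹ Xᵀ Y / n`. -/
def primalSketchedRidge {m n p : ℕ} (lam : ℝ) (L : Fin m → Fin n → ℝ) (X : Fin n → Fin p → ℝ)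
    (Y : Fin n → ℝ) : Fin p → ℝ :=
  ((1 / (n : ℝ)) • ((Matrix.of X)ᵀ * (Matrix.of L)ᵀ * Matrix.of L * Matrix.of X) +
      lam • (1 : Matrix (Fin p) (Fin p) ℝ))⁻¹ *ᵥ
    ((1 / (n : ℝ)) • ((Matrix.of X)ᵀ *ᵥ Y))

/-- The response `Y = X β + ε` of the linear model. -/
def linearResponse {n p : ℕ} (X : Fin n → Fin p → ℝ) (β : Fin p → ℝ) (ε : Fin n → ℝ) :
    Fin n → ℝ :=
  Matrix.of X *ᵥ β + ε

/-- The squared Euclidean norm of a vector. -/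
def sqNorm {p : ℕ} (v : Fin p → ℝ) : ℝ := ∑ i, v i ^ 2

/-- The squared estimation error `‖β̂ - β‖₂²` of primal sketched ridge regression on the response
`Y = X β + ε`; its expectation is the MSE. -/
def sqError {m n p : ℕ} (lam : ℝ) (L : Fin m → Fin n → ℝ) (X : Fin n → Fin p → ℝ)
    (β : Fin p → ℝ) (ε : Fin n → ℝ) : ℝ :=
  sqNorm (primalSketchedRidge lam L X (linearResponse X β ε) - β)

/-- The integrand `‖(Xᵀ Lᵀ L X / n + lam I_p)⁻¹ (Xᵀ X / n) β - β‖₂²` of the squared bias.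
The estimator is linear in the response, so averaging it over the mean zero noise amounts to
replacing the response by its noiseless part `X β`. -/
def sqBias {m n p : ℕ} (lam : ℝ) (L : Fin m → Fin n → ℝ) (X : Fin n → Fin p → ℝ)
    (β : Fin p → ℝ) : ℝ :=
  sqNorm (primalSketchedRidge lam L X (linearResponse X β 0) - β)

/-- The integrand of the variance: the squared distance of the estimator from its average over
the noise. -/
def sqDeviation {m n p : ℕ} (lam : ℝ) (L : Fin m → Fin n → ℝ) (X : Fin n → Fin p → ℝ)
    (β : Fin p → ℝ) (ε : Fin n → ℝ) : ℝ :=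
  sqNorm (primalSketchedRidge lam L X (linearResponse X β ε) -
    primalSketchedRidge lam L X (linearResponse X β 0))

/-- The limiting squared bias. -/
def limitSqBias (α lam γ ξ : ℝ) : ℝ :=
  α ^ 2 * (((lam + ξ - 1) ^ 2 + γ * (1 - ξ)) * mpTheta 2 (γ / ξ) (lam / ξ)) / ξ ^ 2

/-- The limiting variance. -/
def limitVariance (σ lam γ ξ : ℝ) : ℝ :=
  γ * σ ^ 2 *
    ((ξ * mpTheta 1 (γ / ξ) (lam / ξ) - (lam + ξ - 1) * mpTheta 2 (γ / ξ) (lam / ξ)) / ξ ^ 2)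

end

/-! Completing the rows of `L` to an orthonormal basis and using rotation invariance, the design
becomes two independent Gaussian blocks, `W₁ = LX` with `m` rows and `W₂` with `N = n - m` rows, and
`XᵀX = W₁ᵀW₁ + W₂ᵀW₂`. With `c = 1/n` and `R = (c W₁ᵀW₁ + lam)⁻¹`, the bias matrix is `R (c W₂ᵀW₂) -
lam R` and the noise matrix is `c R Xᵀ`. Since `R` does not involve `W₂`, exact Wishart moments in
`W₂` reduce both expected squared Frobenius norms to `E tr R` and `E ‖R‖²`
(`integral_prod_frobSq_sketch`). This holds for every fixed `L` with orthonormal rows, so the law of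
the sketch drops out. Averaging over `β` and `ε` multiplies by `α²/p` and `σ²`, and the cross terms
vanish (`integral_sketchedRidge`).

It remains to find the limits of `E tr R / p` and `E ‖R‖² / p`. For the first, Sherman–Morrison
gives `p - lam tr R = ∑ c qᵢ / (1 + c qᵢ)`, where `qᵢ` is the quadratic form of row `i` in the
resolvent without that row. Each `qᵢ` is close to a trace by the variance of Gaussian quadratic
forms, and that trace is close to its mean by bounded differences. Thus `x = c E tr R` nearly solves
`p/n - lam x = (m/n) x / (1 + x)` (`abs_expTrace_selfConsistent_le`). The limiting equation has one
positive root and is stable among nonnegative approximate solutions (`abs_sub_le_of_approx_root`).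
An explicit antiderivative identifies that root with the Marchenko–Pastur Stieltjes transform
(`mpTheta_one_eq`).

For the second limit, `‖R‖²` is minus the `lam`-derivative of `tr R`. Difference quotients
approximate it with an error linear in the step and uniform in `n`, and the same holds for
`mpTheta`, so the convergence transfers (`tendsto_of_diffQuot`). -/

noncomputable section

/-! ### Deterministic resolvent bounds and rank-one perturbations. -/

section Resolvent

set_option linter.unusedSectionVars false

variable {ι κ : Type*} [Fintype ι] [Fintype κ] [DecidableEq κ]

/-- The resolvent `(A + lam I)⁻¹`. -/
def ridgeResolvent (lam : ℝ) (A : Matrix κ κ ℝ) : Matrix κ κ ℝ :=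
  (A + lam • (1 : Matrix κ κ ℝ))⁻¹

/-- The scaled Gram matrix `c ZᵀZ` of the rows of `Z`. -/
def scaledGram (c : ℝ) (Z : ι → κ → ℝ) : Matrix κ κ ℝ :=
  c • ((Matrix.of Z)ᵀ * Matrix.of Z)

lemma scaledGram_posSemidef {c : ℝ} (hc : 0 ≤ c) (Z : ι → κ → ℝ) :
    (scaledGram c Z).PosSemidef := by
  have h := Matrix.posSemidef_conjTranspose_mul_self (Matrix.of Z)
  rw [Matrix.conjTranspose_eq_transpose_of_trivial] at h
  exact h.smul hc

lemma scaledGram_apply (c : ℝ) (Z : ι → κ → ℝ) (i j : κ) :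
    scaledGram c Z i j = c * ∑ a, Z a i * Z a j := by
  simp [scaledGram, Matrix.mul_apply]

lemma posDef_add_smul_one {lam : ℝ} (hlam : 0 < lam) {A : Matrix κ κ ℝ} (hA : A.PosSemidef) :
    (A + lam • (1 : Matrix κ κ ℝ)).PosDef :=
  Matrix.PosDef.posSemidef_add hA (Matrix.PosDef.one.smul hlam)

lemma mul_ridgeResolvent {lam : ℝ} (hlam : 0 < lam) {A : Matrix κ κ ℝ} (hA : A.PosSemidef) :
    (A + lam • (1 : Matrix κ κ ℝ)) * ridgeResolvent lam A = 1 :=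
  Matrix.mul_nonsing_inv _ ((Matrix.isUnit_iff_isUnit_det _).1 (posDef_add_smul_one hlam hA).isUnit)

lemma ridgeResolvent_mul {lam : ℝ} (hlam : 0 < lam) {A : Matrix κ κ ℝ} (hA : A.PosSemidef) :
    ridgeResolvent lam A * (A + lam • (1 : Matrix κ κ ℝ)) = 1 :=
  Matrix.nonsing_inv_mul _ ((Matrix.isUnit_iff_isUnit_det _).1 (posDef_add_smul_one hlam hA).isUnit)

lemma ridgeResolvent_transpose (lam : ℝ) {A : Matrix κ κ ℝ} (hA : A.PosSemidef) :
    (ridgeResolvent lam A)ᵀ = ridgeResolvent lam A := by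
  have : Aᵀ = A := by simpa using hA.isHermitian.eq
  simp [ridgeResolvent, Matrix.transpose_nonsing_inv, this]

lemma ridgeResolvent_mul_self {lam : ℝ} (hlam : 0 < lam) {A : Matrix κ κ ℝ}
    (hA : A.PosSemidef) :
    ridgeResolvent lam A * A = 1 - lam • ridgeResolvent lam A := by
  have := ridgeResolvent_mul hlam hA
  rw [Matrix.mul_add, Matrix.mul_smul, Matrix.mul_one] at this
  exact eq_sub_of_add_eq this

lemma posSemidef_dotProduct_nonneg {A : Matrix κ κ ℝ} (hA : A.PosSemidef) (y : κ → ℝ) :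
    0 ≤ y ⬝ᵥ A *ᵥ y := by
  simpa using hA.dotProduct_mulVec_nonneg y

lemma mulVec_ridgeResolvent_add {lam : ℝ} (hlam : 0 < lam) {A : Matrix κ κ ℝ}
    (hA : A.PosSemidef) (v : κ → ℝ) :
    A *ᵥ (ridgeResolvent lam A *ᵥ v) + lam • (ridgeResolvent lam A *ᵥ v) = v := by
  have := congrArg (· *ᵥ v) (mul_ridgeResolvent hlam hA)
  simpa [Matrix.add_mul, Matrix.add_mulVec, ← Matrix.mulVec_mulVec, Matrix.smul_mulVec] using this

/-- With `y = Rv` one has `v = Ay + lam y`; pair this with `y` and drop `yᵀAy ≥ 0`. -/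
lemma ridgeResolvent_sq_le_dotProduct {lam : ℝ} (hlam : 0 < lam) {A : Matrix κ κ ℝ}
    (hA : A.PosSemidef) (v : κ → ℝ) :
    lam * ((ridgeResolvent lam A *ᵥ v) ⬝ᵥ (ridgeResolvent lam A *ᵥ v)) ≤
      v ⬝ᵥ (ridgeResolvent lam A *ᵥ v) := by
  have h := mulVec_ridgeResolvent_add hlam hA v
  set y := ridgeResolvent lam A *ᵥ v
  rw [← h, add_dotProduct, smul_dotProduct, smul_eq_mul]
  have := posSemidef_dotProduct_nonneg hA y
  rw [dotProduct_comm] at this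
  linarith

/-- The operator norm bound `‖R‖ ≤ 1/lam` without diagonalization: all three terms in the expansion
of `‖Ay + lam y‖²` are nonnegative. -/
lemma ridgeResolvent_mulVec_sq_le {lam : ℝ} (hlam : 0 < lam) {A : Matrix κ κ ℝ}
    (hA : A.PosSemidef) (v : κ → ℝ) :
    (ridgeResolvent lam A *ᵥ v) ⬝ᵥ (ridgeResolvent lam A *ᵥ v) ≤ lam⁻¹ ^ 2 * (v ⬝ᵥ v) := by
  have h := mulVec_ridgeResolvent_add hlam hA v
  set y := ridgeResolvent lam A *ᵥ v
  have h1 : lam ^ 2 * (y ⬝ᵥ y) ≤ v ⬝ᵥ v := by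
    rw [← h]
    simp only [add_dotProduct, smul_dotProduct, dotProduct_add, dotProduct_smul, smul_eq_mul]
    have h2 := posSemidef_dotProduct_nonneg hA y
    have h3 : 0 ≤ (A *ᵥ y) ⬝ᵥ (A *ᵥ y) := dotProduct_self_star_nonneg (A *ᵥ y)
    rw [dotProduct_comm (A *ᵥ y) y]
    nlinarith [mul_nonneg hlam.le h2]
  rw [inv_pow, inv_mul_eq_div, le_div_iff₀ (by positivity)]
  linarith

lemma ridgeResolvent_dotProduct_nonneg {lam : ℝ} (hlam : 0 < lam) {A : Matrix κ κ ℝ}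
    (hA : A.PosSemidef) (v : κ → ℝ) : 0 ≤ v ⬝ᵥ (ridgeResolvent lam A *ᵥ v) :=
  posSemidef_dotProduct_nonneg (posDef_add_smul_one hlam hA).inv.posSemidef v

lemma sq_le_dotProduct_self (v : κ → ℝ) (i : κ) : v i ^ 2 ≤ v ⬝ᵥ v := by
  rw [dotProduct, sq]
  exact Finset.single_le_sum (f := fun i => v i * v i) (fun i _ => mul_self_nonneg _)
    (Finset.mem_univ i)

lemma abs_ridgeResolvent_apply_le {lam : ℝ} (hlam : 0 < lam) {A : Matrix κ κ ℝ}
    (hA : A.PosSemidef) (i j : κ) : |ridgeResolvent lam A i j| ≤ lam⁻¹ := by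
  have h := ridgeResolvent_mulVec_sq_le hlam hA (Pi.single j 1)
  have h2 := sq_le_dotProduct_self (ridgeResolvent lam A *ᵥ (Pi.single j 1)) i
  simp only [Matrix.mulVec_single_one, single_dotProduct, Pi.single_eq_same, mul_one]
    at h h2
  exact abs_le_of_sq_le_sq (h2.trans h) (by positivity)

lemma trace_ridgeResolvent_nonneg {lam : ℝ} (hlam : 0 < lam) {A : Matrix κ κ ℝ}
    (hA : A.PosSemidef) : 0 ≤ (ridgeResolvent lam A).trace :=
  (posDef_add_smul_one hlam hA).inv.posSemidef.trace_nonneg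

lemma trace_ridgeResolvent_le {lam : ℝ} (hlam : 0 < lam) {A : Matrix κ κ ℝ}
    (hA : A.PosSemidef) : (ridgeResolvent lam A).trace ≤ Fintype.card κ * lam⁻¹ := by
  rw [Matrix.trace, ← nsmul_eq_mul]
  exact Finset.sum_le_card_nsmul _ _ _
    fun i _ => (le_abs_self _).trans (abs_ridgeResolvent_apply_le hlam hA i i)

/-- The squared Frobenius norm. -/
def frobSq {ι κ : Type*} [Fintype ι] [Fintype κ] (M : Matrix ι κ ℝ) : ℝ := ∑ i, ∑ j, M i j ^ 2

lemma frobSq_ridgeResolvent_eq (lam : ℝ) {A : Matrix κ κ ℝ} (hA : A.PosSemidef) :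
    frobSq (ridgeResolvent lam A) = (ridgeResolvent lam A * ridgeResolvent lam A).trace := by
  simp only [frobSq, Matrix.trace, Matrix.diag, Matrix.mul_apply]
  refine Finset.sum_congr rfl fun i _ => Finset.sum_congr rfl fun j _ => ?_
  have : ridgeResolvent lam A j i = ridgeResolvent lam A i j :=
    congrFun (congrFun (ridgeResolvent_transpose lam hA) i) j
  rw [this, sq]

lemma frobSq_nonneg (M : Matrix ι κ ℝ) : 0 ≤ frobSq M := by
  unfold frobSq; positivity

lemma frobSq_ridgeResolvent_le {lam : ℝ} (hlam : 0 < lam) {A : Matrix κ κ ℝ}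
    (hA : A.PosSemidef) :
    frobSq (ridgeResolvent lam A) ≤ Fintype.card κ * lam⁻¹ ^ 2 := by
  rw [frobSq, Finset.sum_comm, ← nsmul_eq_mul]
  refine Finset.sum_le_card_nsmul _ _ _ fun j _ => ?_
  have h := ridgeResolvent_mulVec_sq_le hlam hA (Pi.single j 1)
  have h1 : (Pi.single j (1:ℝ)) ⬝ᵥ (Pi.single j (1:ℝ)) = 1 := by simp
  rw [h1] at h
  simpa [dotProduct, sq] using h

lemma ridgeResolvent_sub {lam h : ℝ} (hlam : 0 < lam) (hh : 0 < h) {A : Matrix κ κ ℝ}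
    (hA : A.PosSemidef) :
    ridgeResolvent lam A - ridgeResolvent (lam + h) A =
      h • (ridgeResolvent lam A * ridgeResolvent (lam + h) A) := by
  rw [ridgeResolvent, ridgeResolvent, Matrix.inv_sub_inv
    (iff_of_true (posDef_add_smul_one hlam hA).isUnit
      (posDef_add_smul_one (add_pos hlam hh) hA).isUnit)]
  simp [add_smul]

/-- The trace of the squared resolvent is a difference quotient of the trace of the resolvent, up
to an error that is linear in the step. -/
lemma abs_trace_diffQuot_sub_frobSq_le {lam h : ℝ} (hlam : 0 < lam) (hh : 0 < h)
    {A : Matrix κ κ ℝ} (hA : A.PosSemidef) :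
    |((ridgeResolvent lam A).trace - (ridgeResolvent (lam + h) A).trace) / h -
      frobSq (ridgeResolvent lam A)| ≤ Fintype.card κ * lam⁻¹ ^ 3 * h := by
  have hlh : 0 < lam + h := by positivity
  set R := ridgeResolvent lam A with hR
  set S := ridgeResolvent (lam + h) A with hS
  have hsub : R - S = h • (R * S) := ridgeResolvent_sub hlam hh hA
  have e1 : (R.trace - S.trace) / h = (R * S).trace := by
    rw [← Matrix.trace_sub, hsub, Matrix.trace_smul, smul_eq_mul]
    field_simp
  -- A second use of the resolvent identity makes the error exactly `-h tr(R²S)`; each diagonal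
  -- entry of `R²S` is then at most `lam⁻³` by three operator norm bounds.
  have e2 : (R.trace - S.trace) / h - frobSq R = -(h * (R * (R * S)).trace) := by
    rw [e1, frobSq_ridgeResolvent_eq lam hA, ← hR]
    have : R * S = R * R - h • (R * (R * S)) := by
      rw [← Matrix.mul_smul, ← hsub]; simp [Matrix.mul_sub]
    conv_lhs => rw [this]
    rw [Matrix.trace_sub, Matrix.trace_smul, smul_eq_mul]; ring
  rw [e2, abs_neg, abs_mul, abs_of_pos hh, mul_comm]
  refine mul_le_mul_of_nonneg_right ?_ hh.le
  rw [Matrix.trace, ← nsmul_eq_mul]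
  refine (Finset.abs_sum_le_sum_abs _ _).trans (Finset.sum_le_card_nsmul _ _ _ fun j _ => ?_)
  have b1 := ridgeResolvent_mulVec_sq_le hlam hA (R *ᵥ (S *ᵥ Pi.single j 1))
  have b2 := ridgeResolvent_mulVec_sq_le hlam hA (S *ᵥ Pi.single j 1)
  have b3 := ridgeResolvent_mulVec_sq_le hlh hA (Pi.single j 1)
  have b4 := sq_le_dotProduct_self (R *ᵥ (R *ᵥ (S *ᵥ Pi.single j 1))) j
  have b5 : (lam + h)⁻¹ ≤ lam⁻¹ := by gcongr; linarith
  rw [← hR] at b1 b2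
  rw [← hS] at b3
  have b6 : (R *ᵥ (R *ᵥ (S *ᵥ Pi.single j 1))) j = (R * (R * S)).diag j := by
    rw [Matrix.mulVec_mulVec, Matrix.mulVec_mulVec, ← Matrix.mul_assoc]
    simp [Matrix.diag]
  rw [b6] at b4
  have b7 : (Pi.single j (1:ℝ)) ⬝ᵥ (Pi.single j (1:ℝ)) = 1 := by simp
  rw [b7, mul_one] at b3
  have b8 : (lam + h)⁻¹ ^ 2 ≤ lam⁻¹ ^ 2 := by gcongr
  refine abs_le_of_sq_le_sq ?_ (by positivity)
  have hl2 : 0 ≤ lam⁻¹ ^ 2 := by positivity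
  calc _ ≤ _ := b4
    _ ≤ _ := b1
    _ ≤ lam⁻¹ ^ 2 * (lam⁻¹ ^ 2 * lam⁻¹ ^ 2) :=
        mul_le_mul_of_nonneg_left (b2.trans (mul_le_mul_of_nonneg_left (b3.trans b8) hl2)) hl2
    _ = _ := by ring

/-- Sherman–Morrison, checked by multiplying out against `A + c zzᵀ + lam`. -/
lemma ridgeResolvent_add_rankOne {lam c : ℝ} (hlam : 0 < lam) (hc : 0 ≤ c) {A : Matrix κ κ ℝ}
    (hA : A.PosSemidef) (z : κ → ℝ) :
    ridgeResolvent lam (A + c • Matrix.vecMulVec z z) = ridgeResolvent lam A -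
      (c / (1 + c * (z ⬝ᵥ ridgeResolvent lam A *ᵥ z))) •
        Matrix.vecMulVec (ridgeResolvent lam A *ᵥ z) (ridgeResolvent lam A *ᵥ z) := by
  have hq := ridgeResolvent_dotProduct_nonneg hlam hA z
  have hq1 : 1 + c * (z ⬝ᵥ ridgeResolvent lam A *ᵥ z) ≠ 0 := by positivity
  have h1 := mul_ridgeResolvent hlam hA
  have hT := ridgeResolvent_transpose lam hA
  conv_lhs => rw [ridgeResolvent]
  refine Matrix.inv_eq_right_inv ?_
  set R := ridgeResolvent lam A
  set q := z ⬝ᵥ R *ᵥ z with hqdef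
  set G := A + lam • (1 : Matrix κ κ ℝ)
  have e0 : A + c • Matrix.vecMulVec z z + lam • (1 : Matrix κ κ ℝ) =
      G + c • Matrix.vecMulVec z z := by simp only [G]; abel
  have e1 : G * Matrix.vecMulVec (R *ᵥ z) (R *ᵥ z) = Matrix.vecMulVec z (R *ᵥ z) := by
    rw [Matrix.mul_vecMulVec, Matrix.mulVec_mulVec, h1, Matrix.one_mulVec]
  have e2 : Matrix.vecMulVec z z * R = Matrix.vecMulVec z (R *ᵥ z) := by
    rw [Matrix.vecMulVec_mul, ← Matrix.mulVec_transpose, hT]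
  have e3 : Matrix.vecMulVec z z * Matrix.vecMulVec (R *ᵥ z) (R *ᵥ z) =
      q • Matrix.vecMulVec z (R *ᵥ z) := by
    rw [Matrix.vecMulVec_mul_vecMulVec, Matrix.vecMulVec_smul]
  rw [e0, Matrix.add_mul, Matrix.mul_sub, Matrix.mul_sub, h1, Matrix.mul_smul, Matrix.mul_smul,
    Matrix.smul_mul, Matrix.smul_mul, e1, e2, e3]
  simp only [smul_smul]
  rw [show ∀ a b c d : Matrix κ κ ℝ, a - b + (c - d) = a + (c - b - d) from fun a b c d => by abel,
    ← sub_smul, ← sub_smul]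
  have : c - c / (1 + c * q) - c / (1 + c * q) * (c * q) = 0 := by field_simp; ring
  rw [this, zero_smul, add_zero]

/-- This trades the resolvent that contains `z` for one that does not, which makes independence
usable when `z` is a row of the design. -/
lemma dotProduct_ridgeResolvent_add_rankOne {lam c : ℝ} (hlam : 0 < lam) (hc : 0 ≤ c)
    {A : Matrix κ κ ℝ} (hA : A.PosSemidef) (z : κ → ℝ) :
    z ⬝ᵥ ridgeResolvent lam (A + c • Matrix.vecMulVec z z) *ᵥ z =
      (z ⬝ᵥ ridgeResolvent lam A *ᵥ z) / (1 + c * (z ⬝ᵥ ridgeResolvent lam A *ᵥ z)) := by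
  have hq := ridgeResolvent_dotProduct_nonneg hlam hA z
  have hq1 : 1 + c * (z ⬝ᵥ ridgeResolvent lam A *ᵥ z) ≠ 0 := by positivity
  rw [ridgeResolvent_add_rankOne hlam hc hA z]
  set q := z ⬝ᵥ ridgeResolvent lam A *ᵥ z with hqd
  have : z ⬝ᵥ (Matrix.vecMulVec (ridgeResolvent lam A *ᵥ z) (ridgeResolvent lam A *ᵥ z)) *ᵥ z =
      q * q := by
    rw [Matrix.vecMulVec_mulVec, dotProduct_comm (ridgeResolvent lam A *ᵥ z) z, ← hqd]
    simp [← hqd]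
  rw [Matrix.sub_mulVec, dotProduct_sub, Matrix.smul_mulVec, dotProduct_smul, this, ← hqd,
    smul_eq_mul]
  field_simp; ring

/-- The trace drops by `c‖Rz‖² / (1 + c zᵀRz)`, and `‖Rz‖² ≤ zᵀRz / lam` bounds this by `1/lam`
whatever the size of `z`. -/
lemma trace_ridgeResolvent_add_rankOne {lam c : ℝ} (hlam : 0 < lam) (hc : 0 ≤ c)
    {A : Matrix κ κ ℝ} (hA : A.PosSemidef) (z : κ → ℝ) :
    (ridgeResolvent lam (A + c • Matrix.vecMulVec z z)).trace ≤ (ridgeResolvent lam A).trace ∧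
    (ridgeResolvent lam A).trace - lam⁻¹ ≤
      (ridgeResolvent lam (A + c • Matrix.vecMulVec z z)).trace := by
  have hq := ridgeResolvent_dotProduct_nonneg hlam hA z
  have hs := ridgeResolvent_sq_le_dotProduct hlam hA z
  rw [ridgeResolvent_add_rankOne hlam hc hA z, Matrix.trace_sub, Matrix.trace_smul,
    Matrix.trace_vecMulVec, smul_eq_mul]
  set q := z ⬝ᵥ ridgeResolvent lam A *ᵥ z
  set s := (ridgeResolvent lam A *ᵥ z) ⬝ᵥ (ridgeResolvent lam A *ᵥ z)
  have hs0 : 0 ≤ s := dotProduct_self_star_nonneg (ridgeResolvent lam A *ᵥ z)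
  have h1 : 0 ≤ c / (1 + c * q) * s := by positivity
  have h2 : c / (1 + c * q) * s ≤ lam⁻¹ := by
    have hsq : s ≤ q / lam := by rw [le_div_iff₀ hlam]; linarith
    calc c / (1 + c * q) * s ≤ c / (1 + c * q) * (q / lam) := by gcongr
      _ = (c * q) / (1 + c * q) * lam⁻¹ := by field_simp
      _ ≤ 1 * lam⁻¹ := by
        gcongr
        rw [div_le_one (by positivity)]; linarith
      _ = lam⁻¹ := one_mul _
  constructor <;> linarith

variable [DecidableEq ι]

/-- Zeroing a row has the effect on the Gram matrix of deleting it, without changing the index type.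
-/
lemma scaledGram_update (c : ℝ) (Z : ι → κ → ℝ) (i : ι) (z : κ → ℝ) :
    scaledGram c (Function.update Z i z) =
      scaledGram c (Function.update Z i 0) + c • Matrix.vecMulVec z z := by
  ext a b
  simp only [scaledGram_apply, Matrix.add_apply, Matrix.smul_apply, Matrix.vecMulVec_apply,
    smul_eq_mul]
  rw [← mul_add, ← Finset.add_sum_erase _ _ (Finset.mem_univ i),
    ← Finset.add_sum_erase (Finset.univ) (fun a_1 => Function.update Z i 0 a_1 a *
      Function.update Z i 0 a_1 b) (Finset.mem_univ i)]
  have : ∀ x ∈ Finset.univ.erase i, Function.update Z i z x a * Function.update Z i z x b =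
      Function.update Z i 0 x a * Function.update Z i 0 x b := by
    intro x hx
    simp [Function.update_of_ne (Finset.ne_of_mem_erase hx)]
  rw [Finset.sum_congr rfl this]
  simp only [Function.update_self, Pi.zero_apply]
  ring

/-- Both matrices are rank-one updates of the one with row `i` zeroed, so both traces lie in the
same interval of length `lam⁻¹`. -/
lemma abs_trace_ridgeResolvent_update_sub_le {lam c : ℝ} (hlam : 0 < lam) (hc : 0 ≤ c)
    (Z : ι → κ → ℝ) (i : ι) (z : κ → ℝ) :
    |(ridgeResolvent lam (scaledGram c (Function.update Z i z))).trace -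
      (ridgeResolvent lam (scaledGram c Z)).trace| ≤ lam⁻¹ := by
  have h1 := trace_ridgeResolvent_add_rankOne hlam hc
    (scaledGram_posSemidef hc (Function.update Z i 0)) z
  have h2 := trace_ridgeResolvent_add_rankOne hlam hc
    (scaledGram_posSemidef hc (Function.update Z i 0)) (Z i)
  rw [← scaledGram_update] at h1 h2
  rw [Function.update_eq_self] at h2
  rw [abs_le]; constructor <;> linarith [h1.1, h1.2, h2.1, h2.2]

/-- The trace identity behind the leave-one-out argument. -/
lemma trace_ridgeResolvent_eq {lam c : ℝ} (hlam : 0 < lam) (hc : 0 ≤ c) (Z : ι → κ → ℝ) :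
    Fintype.card κ - lam * (ridgeResolvent lam (scaledGram c Z)).trace =
      ∑ i, (c * (Z i ⬝ᵥ ridgeResolvent lam (scaledGram c (Function.update Z i 0)) *ᵥ Z i)) /
        (1 + c * (Z i ⬝ᵥ ridgeResolvent lam (scaledGram c (Function.update Z i 0)) *ᵥ Z i)) := by
  -- The left side is `tr(RA)`, which splits over the rows into `c Zᵢᵀ R Zᵢ`; Sherman–Morrison then
  -- turns each summand into leave-one-out form.
  have h0 := congrArg Matrix.trace
    (ridgeResolvent_mul_self hlam (scaledGram_posSemidef hc Z))
  rw [Matrix.trace_sub, Matrix.trace_one, Matrix.trace_smul, smul_eq_mul] at h0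
  rw [← h0]
  have h1 : ∀ i, (c * (Z i ⬝ᵥ ridgeResolvent lam (scaledGram c (Function.update Z i 0)) *ᵥ Z i)) /
        (1 + c * (Z i ⬝ᵥ ridgeResolvent lam (scaledGram c (Function.update Z i 0)) *ᵥ Z i)) =
      c * (Z i ⬝ᵥ ridgeResolvent lam (scaledGram c Z) *ᵥ Z i) := by
    intro i
    have h2 := dotProduct_ridgeResolvent_add_rankOne hlam hc
      (scaledGram_posSemidef hc (Function.update Z i 0)) (Z i)
    rw [← scaledGram_update, Function.update_eq_self] at h2
    rw [h2, mul_div_assoc]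
  rw [Finset.sum_congr rfl fun i _ => h1 i, ← Finset.mul_sum]
  set R := ridgeResolvent lam (scaledGram c Z)
  simp only [Matrix.trace, Matrix.diag, Matrix.mul_apply, scaledGram_apply, dotProduct,
    Matrix.mulVec]
  rw [Finset.mul_sum]
  simp only [Finset.mul_sum]
  calc _ = ∑ x, ∑ j, ∑ i, c * (Z i x * (R x j * Z i j)) := by
        refine Finset.sum_congr rfl fun x _ => Finset.sum_congr rfl fun y _ =>
          Finset.sum_congr rfl fun a _ => by ring
    _ = ∑ x, ∑ i, ∑ j, c * (Z i x * (R x j * Z i j)) :=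
        Finset.sum_congr rfl fun x _ => Finset.sum_comm
    _ = _ := Finset.sum_comm

end Resolvent

/-! ### Gaussian vectors and matrices: invariances and moments up to order four. -/

section GaussianVectors

set_option linter.unusedSectionVars false

variable {ι ν κ : Type*} [Fintype ι] [Fintype ν] [Fintype κ]

/-- The law of a vector with iid standard normal entries. -/
abbrev gaussianVec (κ : Type*) [Fintype κ] : Measure (κ → ℝ) :=
  Measure.pi fun _ => gaussianReal 0 1

/-- The law of a matrix with iid standard normal entries. -/
abbrev gaussianMat (ι κ : Type*) [Fintype ι] [Fintype κ] : Measure (ι → κ → ℝ) :=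
  Measure.pi fun _ => gaussianVec κ

lemma integral_sq_gaussianReal : ∫ x, x ^ 2 ∂(gaussianReal 0 1) = 1 := by
  have h := variance_fun_id_gaussianReal (μ := 0) (v := 1)
  rw [variance_eq_integral (by fun_prop)] at h
  simpa using h

/-- The fourth derivative at `0` of the moment generating function `exp(t²/2)`; each derivative
replaces the polynomial factor `q` by `q' + tq`. -/
lemma integral_pow_four_gaussianReal : ∫ x, x ^ 4 ∂(gaussianReal 0 1) = 3 := by
  have h0 : (0 : ℝ) ∈ interior (integrableExpSet (id : ℝ → ℝ) (gaussianReal 0 1)) := by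
    simp
  have h := iteratedDeriv_mgf_zero h0 4
  have hm : mgf (id : ℝ → ℝ) (gaussianReal 0 1) = fun t => Real.exp (t ^ 2 / 2) := by
    rw [mgf_id_gaussianReal]; simp
  have e : ∀ (q q' : ℝ → ℝ), (∀ t, HasDerivAt q (q' t) t) →
      deriv (fun t => q t * Real.exp (t ^ 2 / 2)) =
        fun t => (q' t + t * q t) * Real.exp (t ^ 2 / 2) := by
    intro q q' hq
    funext t
    have h1 : HasDerivAt (fun t : ℝ => t ^ 2 / 2) t t := by
      exact ((hasDerivAt_pow 2 t).div_const 2).congr_deriv (by simp)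
    have := ((hq t).mul h1.exp).deriv
    refine this.trans ?_
    ring
  have d0 : mgf (id : ℝ → ℝ) (gaussianReal 0 1) =
      fun t => (fun _ => (1:ℝ)) t * Real.exp (t ^ 2 / 2) := by
    rw [hm]; simp
  have hid : ∀ t : ℝ, HasDerivAt (fun t : ℝ => t) 1 t := fun t => hasDerivAt_id t
  rw [iteratedDeriv_succ, iteratedDeriv_succ, iteratedDeriv_succ, iteratedDeriv_succ,
    iteratedDeriv_zero, d0, e _ (fun _ => 0) (fun t => hasDerivAt_const t 1),
    e _ (fun _ => 1) (fun t => by simpa using hid t),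
    e _ (fun t => 2 * t) (fun t => by
      have := ((hid t).mul (hid t)).const_add 1
      simp only [one_mul, mul_one, zero_add] at this ⊢
      exact this.congr_deriv (by ring)),
    e _ (fun t => 3 + 3 * t ^ 2) (fun t => by
      have := ((hid t).const_mul 2).add ((hid t).mul (((hid t).mul (hid t)).const_add 1))
      simp only [one_mul, mul_one, zero_add] at this ⊢
      refine this.congr_deriv ?_
      simp only [Pi.mul_apply]; ring)] at h
  simpa using h.symm

lemma memLp_eval_gaussianVec (i : κ) (q : NNReal) :
    MemLp (fun w : κ → ℝ => w i) q (gaussianVec κ) :=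
  (memLp_id_gaussianReal q).comp_measurePreserving (measurePreserving_eval _ i)

lemma memLp_eval_gaussianMat (a : ι) (i : κ) (q : NNReal) :
    MemLp (fun Z : ι → κ → ℝ => Z a i) q (gaussianMat ι κ) :=
  (memLp_eval_gaussianVec i q).comp_measurePreserving (measurePreserving_eval _ a)

lemma memLp_four_mul {Ω : Type*} [MeasurableSpace Ω] {μ : Measure Ω} {f g : Ω → ℝ}
    (hf : MemLp f 4 μ) (hg : MemLp g 4 μ) : MemLp (fun x => f x * g x) 2 μ := by
  have : ENNReal.HolderTriple 4 4 2 := ⟨by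
    rw [← two_mul, show (4 : ENNReal) = 2 * 2 by norm_num,
      ENNReal.mul_inv (by simp) (by simp), ← mul_assoc, ENNReal.mul_inv_cancel (by simp) (by simp),
      one_mul]⟩
  exact hg.mul' hf

lemma memLp_mul_gaussianVec (i j : κ) :
    MemLp (fun w : κ → ℝ => w i * w j) 2 (gaussianVec κ) :=
  memLp_four_mul (memLp_eval_gaussianVec i 4) (memLp_eval_gaussianVec j 4)

lemma integrable_mul_gaussianVec (i j : κ) :
    Integrable (fun w : κ → ℝ => w i * w j) (gaussianVec κ) :=
  (memLp_mul_gaussianVec i j).integrable one_le_two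

lemma integrable_mul_mul_gaussianVec (i j k l : κ) :
    Integrable (fun w : κ → ℝ => w i * w j * (w k * w l)) (gaussianVec κ) :=
  (memLp_mul_gaussianVec i j).integrable_mul (memLp_mul_gaussianVec k l)

lemma integral_eval_comp_gaussianVec (i : κ) (f : ℝ → ℝ) (hf : Continuous f) :
    ∫ w, f (w i) ∂(gaussianVec κ) = ∫ x, f x ∂(gaussianReal 0 1) :=
  integral_comp_eval hf.aestronglyMeasurable

/-- The coordinates of a standard Gaussian vector in an orthonormal basis are again standard
Gaussian. -/
lemma measurePreserving_orthonormalBasis_repr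
    (b : OrthonormalBasis ι ℝ (EuclideanSpace ℝ ν)) :
    MeasurePreserving (fun (x : ν → ℝ) i => (b i).ofLp ⬝ᵥ x) (gaussianVec ν) (gaussianVec ι) := by
  have h1 : MeasurePreserving (WithLp.toLp 2) (gaussianVec ν) (stdGaussian (EuclideanSpace ℝ ν)) :=
    ⟨by fun_prop, map_pi_eq_stdGaussian⟩
  have h2 : MeasurePreserving b.repr (stdGaussian (EuclideanSpace ℝ ν))
      (stdGaussian (EuclideanSpace ℝ ι)) :=
    ⟨b.repr.continuous.measurable, stdGaussian_map b.repr⟩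
  have h3 : MeasurePreserving (WithLp.toLp 2) (gaussianVec ι)
      (stdGaussian (EuclideanSpace ℝ ι)) := ⟨by fun_prop, map_pi_eq_stdGaussian⟩
  have h4 : MeasurePreserving (WithLp.ofLp : EuclideanSpace ℝ ι → ι → ℝ)
      (stdGaussian (EuclideanSpace ℝ ι)) (gaussianVec ι) := by
    refine ⟨by fun_prop, ?_⟩
    rw [← h3.map_eq, Measure.map_map (by fun_prop) (by fun_prop)]
    exact Measure.map_id
  have h := h4.comp (h2.comp h1)
  have e : (WithLp.ofLp ∘ b.repr ∘ WithLp.toLp 2 : (ν → ℝ) → ι → ℝ) =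
      fun x i => (b i).ofLp ⬝ᵥ x := by
    funext x i
    simp only [Function.comp_apply, OrthonormalBasis.repr_apply_apply]
    rw [EuclideanSpace.inner_eq_star_dotProduct]
    simp [dotProduct_comm]
  rwa [e] at h

lemma measurePreserving_curry_gaussianMat :
    MeasurePreserving (MeasurableEquiv.curry ι κ ℝ)
      (Measure.pi fun _ : ι × κ => gaussianReal 0 1) (gaussianMat ι κ) := by
  refine ⟨by fun_prop, ?_⟩
  have := Measure.infinitePi_map_curry (fun (_ : ι) (_ : κ) => gaussianReal 0 1)
  simpa [Measure.infinitePi_eq_pi] using this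

lemma measurePreserving_transpose_gaussianMat :
    MeasurePreserving (fun (Z : ι → κ → ℝ) j i => Z i j) (gaussianMat ι κ) (gaussianMat κ ι) := by
  have h1 := (measurePreserving_curry_gaussianMat (ι := ι) (κ := κ)).symm
  have h2 := measurePreserving_curry_gaussianMat (ι := κ) (κ := ι)
  have h3 := measurePreserving_piCongrLeft (fun _ : κ × ι => gaussianReal 0 1)
    (Equiv.prodComm ι κ)
  have h := h2.comp (h3.comp h1)
  have e : (MeasurableEquiv.curry κ ι ℝ ∘ MeasurableEquiv.piCongrLeft (fun _ => ℝ)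
      (Equiv.prodComm ι κ) ∘ (MeasurableEquiv.curry ι κ ℝ).symm : (ι → κ → ℝ) → κ → ι → ℝ) =
      fun Z j i => Z i j := by
    funext Z j i
    rfl
  rwa [e] at h

/-- Expressing the rows of a Gaussian matrix in an orthonormal basis preserves its law. -/
lemma measurePreserving_rotate_gaussianMat
    (b : OrthonormalBasis ι ℝ (EuclideanSpace ℝ ν)) :
    MeasurePreserving (fun (Z : ν → κ → ℝ) i j => (b i).ofLp ⬝ᵥ fun a => Z a j)
      (gaussianMat ν κ) (gaussianMat ι κ) := by
  -- The change of basis acts on each column separately, so the matrix is transposed, each column is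
  -- rotated, and the matrix is transposed back.
  have h1 := measurePreserving_transpose_gaussianMat (ι := ν) (κ := κ)
  have h2 := measurePreserving_pi (fun _ : κ => gaussianVec ν) (fun _ => gaussianVec ι)
    fun _ => measurePreserving_orthonormalBasis_repr b
  have h3 := measurePreserving_transpose_gaussianMat (ι := κ) (κ := ι)
  exact h3.comp (h2.comp h1)

variable [DecidableEq κ]

/-- Flipping the sign of one coordinate is a measure-preserving involution. -/
lemma integral_gaussianVec_eq_zero_of_odd (a : κ) (f : (κ → ℝ) → ℝ)
    (hodd : ∀ w, f (fun i => if i = a then -w i else w i) = -f w) :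
    ∫ w, f w ∂(gaussianVec κ) = 0 := by
  have hmp : MeasurePreserving (fun (w : κ → ℝ) i => (if i = a then Neg.neg else id) (w i))
      (gaussianVec κ) (gaussianVec κ) := by
    refine measurePreserving_pi _ _ fun i => ?_
    split_ifs
    · refine ⟨measurable_neg, ?_⟩
      have := gaussianReal_map_neg (μ := 0) (v := 1)
      simpa using this
    · exact MeasurePreserving.id _
  have he : MeasurableEmbedding (fun (w : κ → ℝ) i => (if i = a then Neg.neg else id) (w i)) := by
    have : Function.Involutive (fun (w : κ → ℝ) i => (if i = a then Neg.neg else id) (w i)) := by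
      intro w; funext i; dsimp only; split_ifs <;> simp
    exact (MeasurableEquiv.ofInvolutive _ this hmp.measurable).measurableEmbedding
  have h := hmp.integral_comp he f
  have h2 : ∀ w : κ → ℝ, f (fun i => (if i = a then Neg.neg else id) (w i)) = -f w := by
    intro w
    rw [← hodd w]
    congr 1; funext i; split_ifs <;> simp
  simp only [h2, integral_neg] at h
  linarith

lemma integral_mul_gaussianVec (a b : κ) :
    ∫ w, w a * w b ∂(gaussianVec κ) = if a = b then 1 else 0 := by
  split_ifs with h
  · subst h
    rw [← integral_sq_gaussianReal, ← integral_eval_comp_gaussianVec a _ (by fun_prop)]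
    simp [sq]
  · refine integral_gaussianVec_eq_zero_of_odd a _ fun w => ?_
    simp [Ne.symm h]

lemma integral_sq_mul_sq_gaussianVec {a j : κ} (h : a ≠ j) :
    ∫ w, w a ^ 2 * w j ^ 2 ∂(gaussianVec κ) = 1 := by
  have hi : iIndepFun (fun (i : κ) (w : κ → ℝ) => w i) (gaussianVec κ) :=
    iIndepFun_pi (X := fun _ => id) (fun _ => aemeasurable_id)
  have := ((hi.indepFun h).comp (measurable_id.pow_const 2)
    (measurable_id.pow_const 2)).integral_fun_mul_eq_mul_integral
    (Measurable.aestronglyMeasurable (by fun_prop)) (Measurable.aestronglyMeasurable (by fun_prop))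
  simp only [Function.comp_def, id] at this
  rw [this, integral_eval_comp_gaussianVec a (fun x => x ^ 2) (by fun_prop),
    integral_eval_comp_gaussianVec j (fun x => x ^ 2) (by fun_prop), integral_sq_gaussianReal,
    one_mul]

lemma integral_mul_mul_sq_gaussianVec (a b j : κ) :
    ∫ w, w a * w b * (w j * w j) ∂(gaussianVec κ) =
      if a = b then (if a = j then 3 else 1) else 0 := by
  split_ifs with h h'
  · subst h; subst h'
    rw [← integral_pow_four_gaussianReal, ← integral_eval_comp_gaussianVec a _ (by fun_prop)]
    congr 1; funext w; ring
  · subst h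
    rw [← integral_sq_mul_sq_gaussianVec h']
    congr 1; funext w; ring
  -- Flip the sign of whichever of `a`, `b` differs from `j`: it occurs exactly once in the product.
  · rcases eq_or_ne a j with haj | haj
    · refine integral_gaussianVec_eq_zero_of_odd b _ fun w => ?_
      have : j ≠ b := haj ▸ h
      simp [h, this]
    · refine integral_gaussianVec_eq_zero_of_odd a _ fun w => ?_
      simp [Ne.symm h, haj.symm]

lemma integral_dotProduct_mul_gaussianVec (u : κ → ℝ) (j : κ) :
    ∫ w, (u ⬝ᵥ w) * w j ∂(gaussianVec κ) = u j := by
  simp only [dotProduct, Finset.sum_mul, mul_assoc]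
  rw [integral_finsetSum _ fun i _ => (integrable_mul_gaussianVec i j).const_mul (u i)]
  simp [integral_const_mul, integral_mul_gaussianVec]

lemma memLp_dotProduct_mul_gaussianVec (u : κ → ℝ) (j : κ) :
    MemLp (fun w => (u ⬝ᵥ w) * w j) 2 (gaussianVec κ) := by
  simp only [dotProduct, Finset.sum_mul, mul_assoc]
  exact memLp_finsetSum _ fun i _ => (memLp_mul_gaussianVec i j).const_mul (u i)

lemma integral_dotProduct_sq_gaussianVec (u : κ → ℝ) :
    ∫ w, (u ⬝ᵥ w) ^ 2 ∂(gaussianVec κ) = u ⬝ᵥ u := by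
  have : ∀ w : κ → ℝ, (u ⬝ᵥ w) ^ 2 = ∑ j, u j * ((u ⬝ᵥ w) * w j) := by
    intro w
    rw [sq]; nth_rewrite 2 [dotProduct]; rw [Finset.mul_sum]
    exact Finset.sum_congr rfl fun j _ => by ring
  simp only [this]
  rw [integral_finsetSum _ fun i _ =>
    ((memLp_dotProduct_mul_gaussianVec u i).integrable one_le_two).const_mul _]
  simp only [integral_const_mul, integral_dotProduct_mul_gaussianVec]
  rfl

/-- The fourth moments give second moment `‖u‖² + 2 uⱼ²`, and the mean is `uⱼ`. -/
lemma variance_dotProduct_mul_gaussianVec (u : κ → ℝ) (j : κ) :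
    Var[fun w => (u ⬝ᵥ w) * w j; gaussianVec κ] = u ⬝ᵥ u + u j ^ 2 := by
  rw [variance_eq_sub (memLp_dotProduct_mul_gaussianVec u j)]
  simp only [integral_dotProduct_mul_gaussianVec, Pi.pow_apply]
  have : ∀ w : κ → ℝ, ((u ⬝ᵥ w) * w j) ^ 2 =
      ∑ a, ∑ b, u a * u b * (w a * w b * (w j * w j)) := by
    intro w
    have : ((u ⬝ᵥ w) * w j) ^ 2 = ((u ⬝ᵥ w) * (u ⬝ᵥ w)) * (w j * w j) := by ring
    rw [this, dotProduct, Finset.sum_mul_sum, Finset.sum_mul]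
    refine Finset.sum_congr rfl fun a _ => ?_
    rw [Finset.sum_mul]
    exact Finset.sum_congr rfl fun b _ => by ring
  simp only [this]
  rw [integral_finsetSum _ fun a _ => integrable_finsetSum _ fun b _ =>
    (integrable_mul_mul_gaussianVec a b j j).const_mul _]
  simp only [integral_finsetSum _ fun b _ =>
    (integrable_mul_mul_gaussianVec _ b j j).const_mul _, integral_const_mul,
    integral_mul_mul_sq_gaussianVec]
  have : ∀ a, ∑ b, u a * u b * (if a = b then (if a = j then (3:ℝ) else 1) else 0) =
      u a * u a + if a = j then 2 * u a ^ 2 else 0 := by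
    intro a
    simp only [mul_ite, mul_zero, Finset.sum_ite_eq, Finset.mem_univ, if_true]
    split_ifs <;> ring
  simp only [this, Finset.sum_add_distrib, Finset.sum_ite_eq', Finset.mem_univ, if_true,
    dotProduct]
  ring

end GaussianVectors

/-! ### Variance of Gaussian quadratic forms. -/

section QuadraticForm

set_option linter.unusedSectionVars false

variable {κ : Type*} [Fintype κ]

/-- The variance of `|f|` is nonnegative. -/
lemma integral_abs_le_sqrt_integral_sq {Ω : Type*} [MeasurableSpace Ω] {μ : Measure Ω}
    [IsProbabilityMeasure μ] {f : Ω → ℝ} (hf : MemLp f 2 μ) :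
    ∫ x, |f x| ∂μ ≤ √(∫ x, f x ^ 2 ∂μ) := by
  have h := variance_nonneg (fun x => |f x|) μ
  have hf' : MemLp (fun x => |f x|) 2 μ := hf.abs
  rw [variance_eq_sub hf'] at h
  simp only [Pi.pow_apply, sq_abs] at h
  exact Real.le_sqrt_of_sq_le (by linarith)

variable [DecidableEq κ]

lemma memLp_quadraticForm_gaussianVec (M : Matrix κ κ ℝ) :
    MemLp (fun z => z ⬝ᵥ M *ᵥ z) 2 (gaussianVec κ) := by
  simp only [dotProduct, Matrix.mulVec, Finset.mul_sum]
  refine memLp_finsetSum _ fun i _ => memLp_finsetSum _ fun j _ => ?_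
  refine ((memLp_mul_gaussianVec i j).const_mul (M i j)).congr_norm ?_
    (by filter_upwards with w using by ring_nf)
  exact Measurable.aestronglyMeasurable (by fun_prop)

lemma quadraticForm_eq_sum_eigenvalues {M : Matrix κ κ ℝ} (hM : M.IsHermitian) (z : κ → ℝ) :
    z ⬝ᵥ M *ᵥ z = ∑ i, hM.eigenvalues i * ((hM.eigenvectorBasis i).ofLp ⬝ᵥ z) ^ 2 := by
  have hT : Mᵀ = M := by simpa using hM.eq
  have h := hM.eigenvectorBasis.sum_inner_mul_inner (WithLp.toLp 2 z) (WithLp.toLp 2 (M *ᵥ z))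
  simp only [EuclideanSpace.inner_eq_star_dotProduct, star_trivial] at h
  rw [dotProduct_comm, ← h]
  refine Finset.sum_congr rfl fun i _ => ?_
  have h1 : M *ᵥ z ⬝ᵥ (hM.eigenvectorBasis i).ofLp =
      hM.eigenvalues i * ((hM.eigenvectorBasis i).ofLp ⬝ᵥ z) := by
    rw [dotProduct_comm, Matrix.dotProduct_mulVec, ← Matrix.mulVec_transpose, hT,
      hM.mulVec_eigenvectorBasis, smul_dotProduct, smul_eq_mul]
  rw [h1]; ring

lemma frobSq_eq_sum_sq_eigenvalues {M : Matrix κ κ ℝ} (hM : M.IsHermitian) :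
    frobSq M = ∑ i, hM.eigenvalues i ^ 2 := by
  have h1 : ∀ a, ∑ j, M a j ^ 2 = ∑ i, ((M *ᵥ (hM.eigenvectorBasis i).ofLp) a) ^ 2 := by
    intro a
    have h := hM.eigenvectorBasis.sum_sq_inner_right (WithLp.toLp 2 (M a))
    rw [EuclideanSpace.real_norm_sq_eq] at h
    simp only [EuclideanSpace.inner_eq_star_dotProduct, star_trivial] at h
    exact h.symm
  rw [frobSq, Finset.sum_congr rfl fun a _ => h1 a, Finset.sum_comm]
  refine Finset.sum_congr rfl fun i _ => ?_
  rw [hM.mulVec_eigenvectorBasis]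
  have h := hM.eigenvectorBasis.orthonormal.1 i
  have h2 := EuclideanSpace.real_norm_sq_eq (hM.eigenvectorBasis i)
  rw [h] at h2
  simp only [Pi.smul_apply, smul_eq_mul, mul_pow, ← Finset.mul_sum]
  rw [← h2]; ring

lemma variance_sq_gaussianReal : Var[fun x => x ^ 2; gaussianReal 0 1] = 2 := by
  have h2 : MemLp (fun x : ℝ => x ^ 2) 2 (gaussianReal 0 1) := by
    have := memLp_four_mul (memLp_id_gaussianReal (μ := 0) (v := 1) 4)
      (memLp_id_gaussianReal (μ := 0) (v := 1) 4)
    simpa [sq] using this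
  rw [variance_eq_sub h2]
  have : ∀ x : ℝ, ((fun x : ℝ => x ^ 2) ^ 2) x = x ^ 4 := fun x => by
    simp only [Pi.pow_apply]; ring
  simp only [this, integral_pow_four_gaussianReal, integral_sq_gaussianReal]
  norm_num

lemma memLp_sq_gaussianReal (c : ℝ) :
    MemLp (fun x : ℝ => c * x ^ 2) 2 (gaussianReal 0 1) := by
  have := memLp_four_mul (memLp_id_gaussianReal (μ := 0) (v := 1) 4)
    (memLp_id_gaussianReal (μ := 0) (v := 1) 4)
  simpa [sq] using this.const_mul c

/-- In an eigenbasis the form is a sum of independent terms `lᵢ yᵢ²` with standard normal `yᵢ`, of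
mean `lᵢ` and variance `2 lᵢ²`. -/
lemma integral_quadraticForm_sub_trace_sq {M : Matrix κ κ ℝ} (hM : M.IsHermitian) :
    ∫ z, (z ⬝ᵥ M *ᵥ z - M.trace) ^ 2 ∂(gaussianVec κ) = 2 * frobSq M := by
  set l := hM.eigenvalues with hl
  set F : (κ → ℝ) → ℝ := ∑ i, fun y => l i * y i ^ 2 with hF
  have hmp := measurePreserving_orthonormalBasis_repr hM.eigenvectorBasis
  have e : ∀ z : κ → ℝ, z ⬝ᵥ M *ᵥ z - M.trace =
      F (fun i => (hM.eigenvectorBasis i).ofLp ⬝ᵥ z) - ∑ i, l i := by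
    intro z
    rw [quadraticForm_eq_sum_eigenvalues hM, hM.trace_eq_sum_eigenvalues]
    simp [hF, hl]
  have hF' : F = fun y => ∑ i, l i * y i ^ 2 := by
    funext y; simp [hF]
  have hFm : Measurable F := by rw [hF']; fun_prop
  have hmean : ∫ y, F y ∂(gaussianVec κ) = ∑ i, l i := by
    have hint : ∀ i, Integrable (fun y : κ → ℝ => l i * y i ^ 2) (gaussianVec κ) := fun i => by
      simpa [sq] using (integrable_mul_gaussianVec i i).const_mul (l i)
    rw [hF', integral_finsetSum _ fun i _ => hint i]
    refine Finset.sum_congr rfl fun i _ => ?_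
    rw [integral_const_mul, integral_eval_comp_gaussianVec i (fun x => x ^ 2) (by fun_prop),
      integral_sq_gaussianReal, mul_one]
  have hvar : Var[F; gaussianVec κ] = ∑ i, 2 * l i ^ 2 := by
    rw [hF, variance_sum_pi (X := fun i x => l i * x ^ 2) fun i => memLp_sq_gaussianReal (l i)]
    refine Finset.sum_congr rfl fun i _ => ?_
    rw [variance_const_mul, variance_sq_gaussianReal]; ring
  rw [variance_eq_integral hFm.aemeasurable, hmean] at hvar
  simp only [e]
  rw [← hmp.map_eq, integral_map hmp.measurable.aemeasurable
    (Measurable.aestronglyMeasurable (by fun_prop))] at hvar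
  rw [hvar, frobSq_eq_sum_sq_eigenvalues hM, Finset.mul_sum]

lemma integral_abs_quadraticForm_sub_trace_le {M : Matrix κ κ ℝ} (hM : M.IsHermitian) :
    ∫ z, |z ⬝ᵥ M *ᵥ z - M.trace| ∂(gaussianVec κ) ≤ √(2 * frobSq M) := by
  rw [← integral_quadraticForm_sub_trace_sq hM]
  exact integral_abs_le_sqrt_integral_sq
    ((memLp_quadraticForm_gaussianVec M).sub (memLp_const _))

end QuadraticForm

/-! ### Measurability of resolvents. -/

section Measurability

variable {Ω κ : Type*} [MeasurableSpace Ω] [Fintype κ] [DecidableEq κ]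

lemma measurable_det {A : Ω → Matrix κ κ ℝ} (hA : ∀ i j, Measurable fun ω => A ω i j) :
    Measurable fun ω => (A ω).det := by
  simp only [Matrix.det_apply]
  refine Finset.measurable_sum _ fun σ _ => ?_
  exact (Finset.measurable_prod _ fun i _ => hA _ _).const_smul _

/-- The adjugate formula holds for the total inverse, so no invertibility is needed. -/
lemma measurable_inv_apply {A : Ω → Matrix κ κ ℝ} (hA : ∀ i j, Measurable fun ω => A ω i j)
    (i j : κ) : Measurable fun ω => (A ω)⁻¹ i j := by
  simp only [Matrix.inv_def, Matrix.smul_apply, smul_eq_mul, Ring.inverse_eq_inv',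
    Matrix.adjugate_apply]
  refine (measurable_det hA).inv.mul (measurable_det fun a b => ?_)
  simp only [Matrix.updateRow_apply]
  split_ifs
  · exact measurable_const
  · exact hA a b

lemma measurable_ridgeResolvent {A : Ω → Matrix κ κ ℝ} (hA : ∀ i j, Measurable fun ω => A ω i j)
    (lam : ℝ) (i j : κ) : Measurable fun ω => ridgeResolvent lam (A ω) i j := by
  refine measurable_inv_apply (fun a b => ?_) i j
  exact (hA a b).add_const _

lemma measurable_scaledGram {ι : Type*} [Fintype ι] {Z : Ω → ι → κ → ℝ} (hZ : Measurable Z)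
    (c : ℝ) (i j : κ) : Measurable fun ω => scaledGram c (Z ω) i j := by
  simp only [scaledGram_apply]
  fun_prop

lemma measurable_trace_ridgeResolvent {ι : Type*} [Fintype ι] (lam c : ℝ) :
    Measurable fun Z : ι → κ → ℝ => (ridgeResolvent lam (scaledGram c Z)).trace :=
  Finset.measurable_sum _ fun i _ =>
    measurable_ridgeResolvent (fun a b => measurable_scaledGram measurable_id c a b) lam i i

end Measurability

/-! ### Resampling and bounded differences on product spaces. -/

section ProductMeasure

/-- Resampling one coordinate preserves a product measure. -/
lemma measurePreserving_update {ι : Type*} [Fintype ι] [DecidableEq ι] {E : Type*}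
    [MeasurableSpace E] (μ : ι → Measure E) [∀ i, IsProbabilityMeasure (μ i)] (i : ι) :
    MeasurePreserving (fun q : (ι → E) × E => Function.update q.1 i q.2)
      ((Measure.pi μ).prod (μ i)) (Measure.pi μ) := by
  have hm : Measurable (fun q : (ι → E) × E => Function.update q.1 i q.2) := by
    refine measurable_pi_iff.2 fun a => ?_
    simp only [Function.update_apply]
    split_ifs <;> fun_prop
  refine ⟨hm, (Measure.pi_eq fun s hs => ?_).symm⟩
  rw [Measure.map_apply hm (MeasurableSet.univ_pi hs)]
  have : (fun q : (ι → E) × E => Function.update q.1 i q.2) ⁻¹' (Set.univ.pi s) =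
      (Set.univ.pi (Function.update s i Set.univ)) ×ˢ s i := by
    ext ⟨x, y⟩
    simp only [Set.mem_preimage, Set.mem_pi, Set.mem_univ, true_imp_iff, Set.mem_prod]
    constructor
    · intro h
      refine ⟨fun a => ?_, by simpa using h i⟩
      rcases eq_or_ne a i with rfl | ha
      · simp
      · simpa [ha] using h a
    · rintro ⟨h1, h2⟩ a
      rcases eq_or_ne a i with rfl | ha
      · simpa using h2
      · simpa [ha] using h1 a
  rw [this, Measure.prod_prod, Measure.pi_pi, ← Finset.mul_prod_erase _ _ (Finset.mem_univ i),
    ← Finset.mul_prod_erase _ (fun j => μ j (s j)) (Finset.mem_univ i)]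
  simp only [Function.update_self, measure_univ, one_mul]
  rw [mul_comm]
  congr 1
  refine Finset.prod_congr rfl fun a ha => ?_
  rw [Function.update_of_ne (Finset.ne_of_mem_erase ha)]

lemma integrable_of_measurable_of_abs_le {A : Type*} [MeasurableSpace A] {μ : Measure A}
    [IsFiniteMeasure μ] {f : A → ℝ} (hf : Measurable f) {C : ℝ} (hC : ∀ a, |f a| ≤ C) :
    Integrable f μ :=
  Integrable.of_bound hf.aestronglyMeasurable C (by filter_upwards with a using hC a)

/-- Law of total variance: `v` bounds the fluctuation within a slice, and the slice means oscillate
by at most `c`. -/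
lemma integral_sub_integral_sq_prod_le {A B : Type*} [MeasurableSpace A] [MeasurableSpace B]
    {μ : Measure A} {ν : Measure B} [IsProbabilityMeasure μ] [IsProbabilityMeasure ν]
    {f : A × B → ℝ} (hf : Measurable f) {C c v : ℝ} (hC : ∀ q, |f q| ≤ C)
    (hc : ∀ a a' b, |f (a, b) - f (a', b)| ≤ c)
    (hv : ∀ a, ∫ b, (f (a, b) - ∫ b', f (a, b') ∂ν) ^ 2 ∂ν ≤ v) :
    ∫ q, (f q - ∫ q', f q' ∂(μ.prod ν)) ^ 2 ∂(μ.prod ν) ≤ v + c ^ 2 := by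
  set g : A → ℝ := fun a => ∫ b, f (a, b) ∂ν with hg
  have hfi : Integrable f (μ.prod ν) := integrable_of_measurable_of_abs_le hf hC
  have hfa : ∀ a, Integrable (fun b => f (a, b)) ν := fun a =>
    integrable_of_measurable_of_abs_le (by fun_prop) fun b => hC (a, b)
  have hgm : Measurable g := hf.stronglyMeasurable.integral_prod_right'.measurable
  have hgC : ∀ a, |g a| ≤ C := fun a => by
    have := norm_integral_le_of_norm_le_const (μ := ν) (f := fun b => f (a, b))
      (by filter_upwards with b using hC (a, b))
    simpa using this
  set F := ∫ q', f q' ∂(μ.prod ν) with hF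
  have hFg : F = ∫ a, g a ∂μ := integral_prod f hfi
  have hFC : |F| ≤ C := by
    have := norm_integral_le_of_norm_le_const (μ := μ.prod ν) (f := f)
      (by filter_upwards with b using hC b)
    simpa using this
  have hgc : ∀ a a', |g a - g a'| ≤ c := fun a a' => by
    rw [hg, ← integral_sub (hfa a) (hfa a')]
    have := norm_integral_le_of_norm_le_const (μ := ν) (f := fun b => f (a, b) - f (a', b))
      (by filter_upwards with b using hc a a' b)
    simpa using this
  have hgF : ∀ a, |g a - F| ≤ c := fun a => by
    have e : g a - F = ∫ a', (g a - g a') ∂μ := by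
      rw [integral_sub (integrable_const _) (integrable_of_measurable_of_abs_le hgm hgC), hFg]
      simp
    rw [e]
    have := norm_integral_le_of_norm_le_const (μ := μ) (f := fun a' => g a - g a')
      (by filter_upwards with b using hgc a b)
    simpa using this
  have hsq : Integrable (fun q => (f q - F) ^ 2) (μ.prod ν) := by
    refine integrable_of_measurable_of_abs_le (C := (C + C) ^ 2) (by fun_prop) fun q => ?_
    rw [abs_pow]
    gcongr
    exact (abs_sub _ _).trans (add_le_add (hC q) hFC)
  rw [integral_prod _ hsq]
  have hinner : ∀ a, ∫ b, (f (a, b) - F) ^ 2 ∂ν ≤ v + c ^ 2 := fun a => by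
    have hd : Integrable (fun b => f (a, b) - g a) ν := (hfa a).sub (integrable_const _)
    have hd2 : Integrable (fun b => (f (a, b) - g a) ^ 2) ν := by
      refine integrable_of_measurable_of_abs_le (C := (C + C) ^ 2) (by fun_prop) fun b => ?_
      rw [abs_pow]
      gcongr
      exact (abs_sub _ _).trans (add_le_add (hC _) (hgC a))
    -- The cross term integrates to zero because `g a` is the mean of the slice.
    have e : ∀ b, (f (a, b) - F) ^ 2 =
        (f (a, b) - g a) ^ 2 + 2 * (g a - F) * (f (a, b) - g a) + (g a - F) ^ 2 := fun b => by ring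
    simp only [e]
    have hd3 : Integrable (fun b => (f (a, b) - g a) ^ 2 + 2 * (g a - F) * (f (a, b) - g a)) ν :=
      hd2.add (hd.const_mul _)
    rw [integral_add hd3 (integrable_const _),
      integral_add hd2 (hd.const_mul _), integral_const_mul,
      integral_sub (hfa a) (integrable_const _)]
    have h2 : (g a - F) ^ 2 ≤ c ^ 2 := sq_le_sq' (by linarith [(abs_le.1 (hgF a)).1])
      (abs_le.1 (hgF a)).2
    have : ∫ b, f (a, b) ∂ν = g a := rfl
    simp only [integral_const, probReal_univ, smul_eq_mul, one_mul, this, sub_self, mul_zero,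
      add_zero]
    exact add_le_add (hv a) h2
  calc _ ≤ ∫ _, (v + c ^ 2) ∂μ := by
        refine integral_mono_of_nonneg
          (by filter_upwards with a using integral_nonneg fun b => sq_nonneg _)
          (integrable_const _) (by filter_upwards with a using hinner a)
    _ = _ := by simp

/-- A variance bound for functions with bounded differences. -/
lemma integral_sub_integral_sq_le_of_bounded_differences {E : Type*} [MeasurableSpace E]
    (μ : Measure E) [IsProbabilityMeasure μ] {c : ℝ} (m : ℕ) (f : (Fin m → E) → ℝ)
    (hf : Measurable f) {C : ℝ} (hC : ∀ x, |f x| ≤ C)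
    (hc : ∀ x i y, |f (Function.update x i y) - f x| ≤ c) :
    ∫ x, (f x - ∫ x', f x' ∂(Measure.pi fun _ => μ)) ^ 2 ∂(Measure.pi fun _ => μ) ≤ m * c ^ 2 := by
  induction m with
  | zero =>
    have : ∀ x, f x = f default := fun x => congrArg f (Subsingleton.elim _ _)
    simp [this]
  -- Coordinate `0` is split off and adds one `c²`; the induction hypothesis bounds the variance in
  -- the others.
  | succ m ih =>
    have hmp := (measurePreserving_piFinSuccAbove (fun _ : Fin (m + 1) => μ) 0).symm
    set e := (MeasurableEquiv.piFinSuccAbove (fun _ : Fin (m + 1) => E) 0).symm with he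
    have hee : ∀ q, e q = Fin.cons q.1 q.2 := fun q => by
      simp [he, MeasurableEquiv.piFinSuccAbove, Fin.consEquiv]
    have hi : ∀ g : (Fin (m + 1) → E) → ℝ, ∫ x, g x ∂(Measure.pi fun _ => μ) =
        ∫ q, g (e q) ∂(μ.prod (Measure.pi fun _ : Fin m => μ)) := fun g =>
      (hmp.integral_comp e.measurableEmbedding g).symm
    rw [hi, hi]
    have hfe : Measurable fun q => f (e q) := hf.comp e.measurable
    have := integral_sub_integral_sq_prod_le (μ := μ) (ν := Measure.pi fun _ : Fin m => μ)
      (f := fun q => f (e q)) hfe (C := C) (c := c) (v := m * c ^ 2) (fun q => hC _)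
      (fun a a' b => by
        simp only [hee]
        have := hc (Fin.cons a' b) 0 a
        rwa [Fin.update_cons_zero] at this)
      (fun a => by
        refine ih (fun b => f (e (a, b))) (by fun_prop) (fun x => hC _) fun x i y => ?_
        simp only [hee]
        have := hc (Fin.cons a x) i.succ y
        rwa [← Fin.cons_update] at this)
    refine this.trans (le_of_eq ?_)
    push_cast; ring

end ProductMeasure

/-! ### The approximate self-consistent equation for the expected trace. -/

section SelfConsistentEquation

set_option linter.unusedSectionVars false

variable {κ : Type*} [Fintype κ] [DecidableEq κ]

lemma integral_comp_measurePreserving {A B : Type*} [MeasurableSpace A] [MeasurableSpace B]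
    {μ : Measure A} {ν : Measure B} {g : A → B} (hg : MeasurePreserving g μ ν) {f : B → ℝ}
    (hf : AEStronglyMeasurable f ν) : ∫ x, f (g x) ∂μ = ∫ y, f y ∂ν := by
  rw [← hg.map_eq] at hf ⊢
  exact (integral_map hg.measurable.aemeasurable hf).symm

/-- The expected trace of the resolvent of the Gram matrix of `m` Gaussian rows. -/
def expTrace (m : ℕ) (κ : Type*) [Fintype κ] [DecidableEq κ] (c lam : ℝ) : ℝ :=
  ∫ Z, (ridgeResolvent lam (scaledGram c Z)).trace ∂(gaussianMat (Fin m) κ)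

/-- The expected squared Frobenius norm of the resolvent of the Gram matrix of `m` Gaussian rows. -/
def expFrobSq (m : ℕ) (κ : Type*) [Fintype κ] [DecidableEq κ] (c lam : ℝ) : ℝ :=
  ∫ Z, frobSq (ridgeResolvent lam (scaledGram c Z)) ∂(gaussianMat (Fin m) κ)

lemma abs_trace_ridgeResolvent_le {ι : Type*} [Fintype ι] {lam c : ℝ} (hlam : 0 < lam)
    (hc : 0 ≤ c) (Z : ι → κ → ℝ) :
    |(ridgeResolvent lam (scaledGram c Z)).trace| ≤ Fintype.card κ * lam⁻¹ := by
  rw [abs_of_nonneg (trace_ridgeResolvent_nonneg hlam (scaledGram_posSemidef hc Z))]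
  exact trace_ridgeResolvent_le hlam (scaledGram_posSemidef hc Z)

lemma integrable_trace_ridgeResolvent {ι : Type*} [Fintype ι] {lam c : ℝ} (hlam : 0 < lam)
    (hc : 0 ≤ c) : Integrable (fun Z : ι → κ → ℝ =>
      (ridgeResolvent lam (scaledGram c Z)).trace) (gaussianMat ι κ) :=
  integrable_of_measurable_of_abs_le (measurable_trace_ridgeResolvent lam c)
    (abs_trace_ridgeResolvent_le hlam hc)

lemma integrable_frobSq_ridgeResolvent {ι : Type*} [Fintype ι] {lam c : ℝ} (hlam : 0 < lam)
    (hc : 0 ≤ c) : Integrable (fun Z : ι → κ → ℝ =>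
      frobSq (ridgeResolvent lam (scaledGram c Z))) (gaussianMat ι κ) := by
  refine integrable_of_measurable_of_abs_le (C := Fintype.card κ * lam⁻¹ ^ 2) ?_ fun Z => ?_
  · exact Finset.measurable_sum _ fun i _ => Finset.measurable_sum _ fun j _ =>
      (measurable_ridgeResolvent (fun a b => measurable_scaledGram measurable_id c a b)
        lam i j).pow_const 2
  · rw [abs_of_nonneg (frobSq_nonneg _)]
    exact frobSq_ridgeResolvent_le hlam (scaledGram_posSemidef hc Z)

lemma expTrace_nonneg (m : ℕ) {lam c : ℝ} (hlam : 0 < lam) (hc : 0 ≤ c) :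
    0 ≤ expTrace m κ c lam :=
  integral_nonneg fun Z => trace_ridgeResolvent_nonneg hlam (scaledGram_posSemidef hc Z)

lemma expTrace_le (m : ℕ) {lam c : ℝ} (hlam : 0 < lam) (hc : 0 ≤ c) :
    expTrace m κ c lam ≤ Fintype.card κ * lam⁻¹ := by
  have := integral_mono (μ := gaussianMat (Fin m) κ) (integrable_trace_ridgeResolvent hlam hc)
    (integrable_const (Fintype.card κ * lam⁻¹)) fun Z =>
      (trace_ridgeResolvent_le hlam (scaledGram_posSemidef hc Z) :
        (ridgeResolvent lam (scaledGram c Z)).trace ≤ _)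
  simpa [expTrace] using this

lemma abs_diffQuot_expTrace_sub_expFrobSq_le (m : ℕ) {lam c h : ℝ} (hlam : 0 < lam) (hc : 0 ≤ c)
    (hh : 0 < h) :
    |(expTrace m κ c lam - expTrace m κ c (lam + h)) / h - expFrobSq m κ c lam| ≤
      Fintype.card κ * lam⁻¹ ^ 3 * h := by
  have i1 := integrable_trace_ridgeResolvent (ι := Fin m) (κ := κ) hlam hc
  have i2 := integrable_trace_ridgeResolvent (ι := Fin m) (κ := κ) (add_pos hlam hh) hc
  have i3 := integrable_frobSq_ridgeResolvent (ι := Fin m) (κ := κ) hlam hc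
  have i4 : Integrable (fun Z : Fin m → κ → ℝ => ((ridgeResolvent lam (scaledGram c Z)).trace -
      (ridgeResolvent (lam + h) (scaledGram c Z)).trace) / h) (gaussianMat (Fin m) κ) :=
    (i1.sub i2).div_const h
  rw [expTrace, expTrace, expFrobSq, ← integral_sub i1 i2, ← integral_div, ← integral_sub i4 i3]
  have := norm_integral_le_of_norm_le_const (μ := gaussianMat (Fin m) κ)
    (f := fun Z => ((ridgeResolvent lam (scaledGram c Z)).trace -
      (ridgeResolvent (lam + h) (scaledGram c Z)).trace) / h -
        frobSq (ridgeResolvent lam (scaledGram c Z)))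
    (by filter_upwards with Z using
          abs_trace_diffQuot_sub_frobSq_le hlam hh (scaledGram_posSemidef hc Z))
  simpa using this

/-- Replacing one row moves the trace by at most `lam⁻¹`, so bounded differences apply. After
multiplication by `c = 1/n` the deviation is negligible. -/
lemma integral_abs_trace_sub_expTrace_le (m : ℕ) {lam c : ℝ} (hlam : 0 < lam) (hc : 0 ≤ c) :
    ∫ Z, |(ridgeResolvent lam (scaledGram c Z)).trace - expTrace m κ c lam|
      ∂(gaussianMat (Fin m) κ) ≤ √m * lam⁻¹ := by
  have hm := measurable_trace_ridgeResolvent (ι := Fin m) (κ := κ) lam c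
  have h := integral_sub_integral_sq_le_of_bounded_differences (gaussianVec κ) m
    (fun Z => (ridgeResolvent lam (scaledGram c Z)).trace) hm
    (abs_trace_ridgeResolvent_le hlam hc)
    (fun Z i z => abs_trace_ridgeResolvent_update_sub_le hlam hc Z i z)
  have hL : MemLp (fun Z : Fin m → κ → ℝ =>
      (ridgeResolvent lam (scaledGram c Z)).trace - expTrace m κ c lam) 2
      (gaussianMat (Fin m) κ) := by
    refine MemLp.sub ?_ (memLp_const _)
    exact MemLp.of_bound hm.aestronglyMeasurable _
      (by filter_upwards with Z using abs_trace_ridgeResolvent_le hlam hc Z)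
  refine (integral_abs_le_sqrt_integral_sq hL).trans ?_
  rw [show √(m : ℝ) * lam⁻¹ = √(m * lam⁻¹ ^ 2) by
    rw [Real.sqrt_mul (Nat.cast_nonneg m), Real.sqrt_sq (by positivity)]]
  exact Real.sqrt_le_sqrt h

lemma integrable_quadraticForm_of_bounded {Ω : Type*} [MeasurableSpace Ω] {μ : Measure Ω}
    {M : Ω → Matrix κ κ ℝ} {z : Ω → κ → ℝ} {C : ℝ} (hM : ∀ i j, Measurable fun ω => M ω i j)
    (hC : ∀ ω i j, |M ω i j| ≤ C) (hz : ∀ i j, Integrable (fun ω => z ω i * z ω j) μ) :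
    Integrable (fun ω => z ω ⬝ᵥ M ω *ᵥ z ω) μ := by
  simp only [dotProduct, Matrix.mulVec, Finset.mul_sum]
  refine integrable_finsetSum _ fun i _ => integrable_finsetSum _ fun j _ => ?_
  have := (hz i j).bdd_mul (c := C) (hM i j).aestronglyMeasurable
    (by filter_upwards with ω using hC ω i j)
  refine this.congr ?_
  filter_upwards with ω
  ring

lemma measurable_update_zero {ι : Type*} [DecidableEq ι] (i : ι) :
    Measurable fun Z : ι → κ → ℝ => Function.update Z i 0 := by
  refine measurable_pi_iff.2 fun a => ?_
  simp only [Function.update_apply]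
  split_ifs <;> fun_prop

/-- The quadratic form in the leave-one-out resolvent concentrates around its trace. -/
lemma integral_abs_leaveOneOut_sub_trace_le {ι : Type*} [Fintype ι] [DecidableEq ι] {lam c : ℝ}
    (hlam : 0 < lam) (hc : 0 ≤ c) (i : ι) :
    Integrable (fun Z : ι → κ → ℝ =>
        Z i ⬝ᵥ ridgeResolvent lam (scaledGram c (Function.update Z i 0)) *ᵥ Z i)
      (gaussianMat ι κ) ∧
    ∫ Z, |Z i ⬝ᵥ ridgeResolvent lam (scaledGram c (Function.update Z i 0)) *ᵥ Z i -
        (ridgeResolvent lam (scaledGram c (Function.update Z i 0))).trace| ∂(gaussianMat ι κ) ≤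
      √(2 * Fintype.card κ) * lam⁻¹ := by
  set M : (ι → κ → ℝ) → Matrix κ κ ℝ :=
    fun Z => ridgeResolvent lam (scaledGram c (Function.update Z i 0)) with hMdef
  have hMm : ∀ a b, Measurable fun Z => M Z a b := fun a b =>
    measurable_ridgeResolvent
      (fun a b => measurable_scaledGram (measurable_update_zero i) c a b) lam a b
  have hMb : ∀ Z a b, |M Z a b| ≤ lam⁻¹ := fun Z a b =>
    abs_ridgeResolvent_apply_le hlam (scaledGram_posSemidef hc _) a b
  have hint : Integrable (fun Z : ι → κ → ℝ => Z i ⬝ᵥ M Z *ᵥ Z i) (gaussianMat ι κ) := by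
    refine integrable_quadraticForm_of_bounded hMm hMb fun a b => ?_
    exact (measurePreserving_eval (fun _ : ι => gaussianVec κ) i).integrable_comp_of_integrable
      (integrable_mul_gaussianVec a b)
  have htr : Integrable (fun Z : ι → κ → ℝ => (M Z).trace) (gaussianMat ι κ) := by
    refine integrable_of_measurable_of_abs_le (C := Fintype.card κ * lam⁻¹)
      (Finset.measurable_sum _ fun a _ => hMm a a)
      fun Z => abs_trace_ridgeResolvent_le hlam hc _
  refine ⟨hint, ?_⟩
  -- The leave-one-out resolvent does not see row `i`. Resampling that row makes the vector in the
  -- form independent of the matrix, and Fubini allows the variance bound for a fixed matrix.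
  have hmp := measurePreserving_update (fun _ : ι => gaussianVec κ) i
  have hG : Integrable (fun Z : ι → κ → ℝ => |Z i ⬝ᵥ M Z *ᵥ Z i - (M Z).trace|)
    (gaussianMat ι κ) := (hint.sub htr).abs
  have hG' := hmp.integrable_comp_of_integrable hG
  have e1 : ∫ Z, |Z i ⬝ᵥ M Z *ᵥ Z i - (M Z).trace| ∂(gaussianMat ι κ) =
      ∫ q, |q.2 ⬝ᵥ M q.1 *ᵥ q.2 - (M q.1).trace| ∂((gaussianMat ι κ).prod (gaussianVec κ)) := by
    rw [← integral_comp_measurePreserving hmp hG.1]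
    simp [hMdef]
  have e2 : Integrable (fun q : (ι → κ → ℝ) × (κ → ℝ) =>
      |q.2 ⬝ᵥ M q.1 *ᵥ q.2 - (M q.1).trace|) ((gaussianMat ι κ).prod (gaussianVec κ)) := by
    refine hG'.congr ?_
    filter_upwards with q
    simp [hMdef]
  rw [e1, integral_prod _ e2]
  calc _ ≤ ∫ _, √(2 * Fintype.card κ) * lam⁻¹ ∂(gaussianMat ι κ) := by
        refine integral_mono_of_nonneg
          (by filter_upwards with a using integral_nonneg fun b => abs_nonneg _)
          (integrable_const _) ?_
        filter_upwards with Z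
        have hH : (M Z).IsHermitian := by
          rw [Matrix.IsHermitian, Matrix.conjTranspose_eq_transpose_of_trivial]
          exact ridgeResolvent_transpose lam (scaledGram_posSemidef hc _)
        refine (integral_abs_quadraticForm_sub_trace_le hH).trans ?_
        rw [show √(2 * Fintype.card κ : ℝ) * lam⁻¹ = √(2 * (Fintype.card κ * lam⁻¹ ^ 2)) by
          rw [← mul_assoc, Real.sqrt_mul (by positivity) (lam⁻¹ ^ 2), Real.sqrt_sq (by positivity)]]
        gcongr
        exact frobSq_ridgeResolvent_le hlam (scaledGram_posSemidef hc _)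
    _ = _ := by simp

lemma abs_div_one_add_sub_le {x y : ℝ} (hx : 0 ≤ x) (hy : 0 ≤ y) :
    |x / (1 + x) - y / (1 + y)| ≤ |x - y| := by
  have : x / (1 + x) - y / (1 + y) = (x - y) / ((1 + x) * (1 + y)) := by
    field_simp; ring
  rw [this, abs_div]
  refine div_le_self (abs_nonneg _) ?_
  rw [abs_of_pos (by positivity)]
  nlinarith

/-- The approximate self-consistent equation of the expected trace of the resolvent. -/
lemma abs_expTrace_selfConsistent_le (m : ℕ) {lam c : ℝ} (hlam : 0 < lam) (hc : 0 ≤ c) :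
    |Fintype.card κ - lam * expTrace m κ c lam -
      m * (c * expTrace m κ c lam / (1 + c * expTrace m κ c lam))| ≤
      m * (c * ((√(2 * Fintype.card κ) + 1 + √m) * lam⁻¹)) := by
  set t := expTrace m κ c lam with ht
  have ht0 : 0 ≤ t := expTrace_nonneg m hlam hc
  set T : (Fin m → κ → ℝ) → ℝ := fun Z => (ridgeResolvent lam (scaledGram c Z)).trace with hT
  set q : Fin m → (Fin m → κ → ℝ) → ℝ := fun i Z =>
    Z i ⬝ᵥ ridgeResolvent lam (scaledGram c (Function.update Z i 0)) *ᵥ Z i with hq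
  have hTi : Integrable T (gaussianMat (Fin m) κ) := integrable_trace_ridgeResolvent hlam hc
  have hq0 : ∀ i Z, 0 ≤ q i Z := fun i Z =>
    ridgeResolvent_dotProduct_nonneg hlam (scaledGram_posSemidef hc _) _
  have hloo := fun i => integral_abs_leaveOneOut_sub_trace_le (ι := Fin m) (κ := κ) hlam hc i
  have hqi : ∀ i, Integrable (q i) (gaussianMat (Fin m) κ) := fun i => (hloo i).1
  have hφi : ∀ i, Integrable (fun Z => c * q i Z / (1 + c * q i Z)) (gaussianMat (Fin m) κ) := by
    intro i
    refine Integrable.of_bound (C := 1) ?_ ?_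
    · have h1 : AEMeasurable (fun Z => c * q i Z) (gaussianMat (Fin m) κ) :=
        (hqi i).1.aemeasurable.const_mul c
      exact (h1.div (h1.const_add 1)).aestronglyMeasurable
    · filter_upwards with Z
      have := mul_nonneg hc (hq0 i Z)
      rw [Real.norm_eq_abs, abs_of_nonneg (by positivity), div_le_one (by positivity)]
      linarith
  have h1 : Fintype.card κ - lam * t =
      ∑ i, ∫ Z, c * q i Z / (1 + c * q i Z) ∂(gaussianMat (Fin m) κ) := by
    rw [← integral_finsetSum _ fun i _ => hφi i]
    simp only [hq, ← trace_ridgeResolvent_eq hlam hc]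
    rw [integral_sub (integrable_const _) (hTi.const_mul lam), integral_const_mul]
    simp [ht, expTrace, hT]
  have h2 : ∀ i, |∫ Z, c * q i Z / (1 + c * q i Z) ∂(gaussianMat (Fin m) κ) -
      c * t / (1 + c * t)| ≤ c * ((√(2 * Fintype.card κ) + 1 + √m) * lam⁻¹) := by
    intro i
    set S : (Fin m → κ → ℝ) → ℝ := fun Z =>
      (ridgeResolvent lam (scaledGram c (Function.update Z i 0))).trace with hS
    have hSi : Integrable S (gaussianMat (Fin m) κ) :=
      integrable_of_measurable_of_abs_le (C := Fintype.card κ * lam⁻¹)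
        ((measurable_trace_ridgeResolvent lam c).comp (measurable_update_zero i))
        fun Z => abs_trace_ridgeResolvent_le hlam hc _
    have e : ∫ Z, c * q i Z / (1 + c * q i Z) ∂(gaussianMat (Fin m) κ) - c * t / (1 + c * t) =
        ∫ Z, (c * q i Z / (1 + c * q i Z) - c * t / (1 + c * t)) ∂(gaussianMat (Fin m) κ) := by
      rw [integral_sub (hφi i) (integrable_const _)]; simp
    rw [e]
    refine (abs_integral_le_integral_abs).trans ?_
    have b1 : Integrable (fun Z => |q i Z - S Z|) (gaussianMat (Fin m) κ) :=
      ((hqi i).sub hSi).abs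
    have b3 : Integrable (fun Z => |T Z - t|) (gaussianMat (Fin m) κ) :=
      (hTi.sub (integrable_const _)).abs
    have b13 : Integrable (fun Z => |q i Z - S Z| + lam⁻¹ + |T Z - t|) (gaussianMat (Fin m) κ) :=
      (b1.add (integrable_const _)).add b3
    have hpt : ∀ Z, |c * q i Z / (1 + c * q i Z) - c * t / (1 + c * t)| ≤
        c * (|q i Z - S Z| + lam⁻¹ + |T Z - t|) := by
      intro Z
      refine (abs_div_one_add_sub_le (mul_nonneg hc (hq0 i Z)) (mul_nonneg hc ht0)).trans ?_
      rw [← mul_sub, abs_mul, abs_of_nonneg hc]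
      refine mul_le_mul_of_nonneg_left ?_ hc
      have h3 : |S Z - T Z| ≤ lam⁻¹ := abs_trace_ridgeResolvent_update_sub_le hlam hc Z i 0
      -- Three errors: the quadratic form against its trace, the deletion of one row, and the trace
      -- against its mean.
      have : q i Z - t = (q i Z - S Z) + (S Z - T Z) + (T Z - t) := by ring
      rw [this]
      refine (abs_add_le _ _).trans (add_le_add_left ((abs_add_le _ _).trans ?_) _)
      exact add_le_add_right h3 _
    refine (integral_mono_of_nonneg (by filter_upwards with a using abs_nonneg _)
      (b13.const_mul c) (by filter_upwards with Z using hpt Z)).trans ?_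
    have b1' : Integrable (fun Z => |q i Z - S Z| + lam⁻¹) (gaussianMat (Fin m) κ) :=
      b1.add (integrable_const _)
    rw [integral_const_mul, integral_add b1' b3, integral_add b1 (integrable_const _)]
    refine mul_le_mul_of_nonneg_left ?_ hc
    have c1 := (hloo i).2
    have c2 := integral_abs_trace_sub_expTrace_le (κ := κ) m hlam hc
    simp only [integral_const, probReal_univ, smul_eq_mul, one_mul]
    rw [add_mul, add_mul, one_mul]
    exact add_le_add (add_le_add_left c1 _) c2
  have e2 : Fintype.card κ - lam * t - m * (c * t / (1 + c * t)) =
      ∑ i : Fin m, (∫ Z, c * q i Z / (1 + c * q i Z) ∂(gaussianMat (Fin m) κ) -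
        c * t / (1 + c * t)) := by
    rw [h1, Finset.sum_sub_distrib]; simp
  rw [e2]
  refine (Finset.abs_sum_le_sum_abs _ _).trans ?_
  refine (Finset.sum_le_card_nsmul _ _ _ fun i _ => h2 i).trans (le_of_eq ?_)
  simp

end SelfConsistentEquation

/-! ### The Stieltjes transform of the Marchenko–Pastur law. -/

section MarchenkoPastur

/-- The basic semicircle-type integral behind the Stieltjes transform of the Marchenko–Pastur
law. -/
lemma integral_sqrt_div_add {e r l : ℝ} (hr : 0 < r) (hl : r ≤ e + l) :
    IntegrableOn (fun x => √(r ^ 2 - (x - e) ^ 2) / (x + l)) (Set.Icc (e - r) (e + r)) ∧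
    ∫ x in Set.Icc (e - r) (e + r), √(r ^ 2 - (x - e) ^ 2) / (x + l) =
      Real.pi * (e + l - √((e + l) ^ 2 - r ^ 2)) := by
  set d := e + l with hd
  set s := √(d ^ 2 - r ^ 2) with hs
  have hs0 : 0 ≤ s := Real.sqrt_nonneg _
  have hs2 : s ^ 2 = d ^ 2 - r ^ 2 := Real.sq_sqrt (by nlinarith)
  -- With `w` the square root and `y = x + l`, the integrand is `d/w - (x - e)/w - s²/(yw)`,
  -- integrated term by term. The last primitive is written with `w / (s + y)` so that it extends to
  -- both endpoints, where `w = 0`.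
  set F : ℝ → ℝ := fun x => d * Real.arcsin ((x - e) / r) + √(r ^ 2 - (x - e) ^ 2) -
    (s * Real.arcsin ((x - e) / r) +
      2 * (s * Real.arctan (√(r ^ 2 - (x - e) ^ 2) / (s + (x + l))))) with hF
  have hab : e - r ≤ e + r := by linarith
  have hcont : ContinuousOn F (Set.Icc (e - r) (e + r)) := by
    have h1 : Continuous fun x : ℝ => Real.arcsin ((x - e) / r) :=
      Real.continuous_arcsin.comp (by fun_prop)
    have h2 : Continuous fun x : ℝ => √(r ^ 2 - (x - e) ^ 2) := by fun_prop
    have h3 : ContinuousOn (fun x => s * Real.arctan (√(r ^ 2 - (x - e) ^ 2) / (s + (x + l))))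
        (Set.Icc (e - r) (e + r)) := by
      -- When `s = 0` the denominator vanishes at the left endpoint, but then the factor `s` removes
      -- the term.
      rcases hs0.eq_or_lt with h | h
      · simp only [← h, zero_mul]; exact continuousOn_const
      · refine continuousOn_const.mul (Real.continuous_arctan.comp_continuousOn ?_)
        refine h2.continuousOn.div (by fun_prop) fun x hx => ?_
        have := hx.1
        have : 0 < s + (x + l) := by linarith
        exact this.ne'
    exact ((h1.const_mul d |>.add h2).continuousOn).sub
      ((h1.const_mul s).continuousOn.add (continuousOn_const.mul h3))
  have hderiv : ∀ x ∈ Set.Ioo (e - r) (e + r),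
      HasDerivAt F (√(r ^ 2 - (x - e) ^ 2) / (x + l)) x := by
    intro x hx
    have hw2 : 0 < r ^ 2 - (x - e) ^ 2 := by nlinarith [hx.1, hx.2]
    set w := √(r ^ 2 - (x - e) ^ 2) with hw
    have hw0 : 0 < w := Real.sqrt_pos.2 hw2
    have hwsq : w ^ 2 = r ^ 2 - (x - e) ^ 2 := Real.sq_sqrt hw2.le
    have hy : 0 < x + l := by linarith [hx.1]
    have hsy : 0 < s + (x + l) := by linarith
    have hu : HasDerivAt (fun x : ℝ => (x - e) / r) (1 / r) x :=
      ((hasDerivAt_id x).sub_const e).div_const r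
    have h1 : HasDerivAt (fun x : ℝ => Real.arcsin ((x - e) / r)) (1 / w) x := by
      have hne1 : (x - e) / r ≠ -1 := by
        intro h; rw [div_eq_iff hr.ne'] at h; linarith [hx.1]
      have hne2 : (x - e) / r ≠ 1 := by
        intro h; rw [div_eq_iff hr.ne'] at h; linarith [hx.2]
      refine ((Real.hasDerivAt_arcsin hne1 hne2).comp x hu).congr_deriv ?_
      have : √(1 - ((x - e) / r) ^ 2) = w / r := by
        rw [Real.sqrt_eq_iff_mul_self_eq_of_pos (by positivity)]
        field_simp
        exact hwsq
      rw [this]; field_simp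
    have h2 : HasDerivAt (fun x : ℝ => √(r ^ 2 - (x - e) ^ 2)) (-(x - e) / w) x := by
      have h := (((hasDerivAt_id x).sub_const e).pow 2).const_sub (r ^ 2)
      refine (h.sqrt hw2.ne').congr_deriv ?_
      simp only [id, Pi.pow_apply]
      rw [← hw]; field_simp; norm_num; ring
    have h3 : HasDerivAt (fun x => s + (x + l)) 1 x :=
      ((hasDerivAt_id x).add_const l).const_add s
    have h4 := (h2.div h3 hsy.ne').arctan
    refine (((h1.const_mul d).add h2).sub ((h1.const_mul s).add
      ((h4.const_mul s).const_mul 2))).congr_deriv ?_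
    simp only [← hw, Pi.div_apply]
    have hden : 1 + (w / (s + (x + l))) ^ 2 = 2 * (x + l) * (s + d) / (s + (x + l)) ^ 2 := by
      field_simp
      rw [hwsq, hd] at *
      nlinarith [hs2]
    have hsd : 0 < s + d := by linarith
    have hnum : -(x - e) / w * (s + (x + l)) - w * 1 = (s + d) * (s - (x + l)) / w := by
      field_simp
      rw [hwsq]
      have : r ^ 2 = d ^ 2 - s ^ 2 := by linarith
      rw [this, hd]; ring
    rw [hden, hnum]
    have e1 : s * (1 / (2 * (x + l) * (s + d) / (s + (x + l)) ^ 2) *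
        ((s + d) * (s - (x + l)) / w / (s + (x + l)) ^ 2)) =
        s * ((s - (x + l)) / (2 * (x + l) * w)) := by
      field_simp
    rw [e1]
    field_simp
    rw [hwsq]
    have : r ^ 2 = d ^ 2 - s ^ 2 := by linarith
    rw [this, hd]; ring
  have hpos : ∀ x ∈ Set.Ioo (e - r) (e + r), 0 ≤ √(r ^ 2 - (x - e) ^ 2) / (x + l) := by
    intro x hx
    have : 0 < x + l := by linarith [hx.1]
    positivity
  -- A nonnegative derivative of a continuous function is integrable, which covers the integrand
  -- being unbounded at the left edge when `e + l = r`.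
  have hint := intervalIntegral.integrableOn_deriv_of_nonneg hcont hderiv hpos
  refine ⟨(integrableOn_Icc_iff_integrableOn_Ioc).2 hint, ?_⟩
  rw [integral_Icc_eq_integral_Ioc, ← intervalIntegral.integral_of_le hab,
    intervalIntegral.integral_eq_sub_of_hasDerivAt_of_le hab hcont hderiv
      ((intervalIntegrable_iff_integrableOn_Ioc_of_le hab).2 hint)]
  have hr' : r / r = 1 := div_self hr.ne'
  simp only [hF]
  have e1 : e + r - e = r := by ring
  have e2 : e - r - e = -r := by ring
  rw [e1, e2, neg_div, hr', Real.arcsin_neg, Real.arcsin_one]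
  simp only [neg_sq, sub_self, Real.sqrt_zero, zero_div, Real.arctan_zero]
  ring

variable {γ : ℝ}

lemma mp_edge_left (hγ : 0 < γ) : (1 - √γ) ^ 2 = (1 + γ) - 2 * √γ := by
  have := Real.sq_sqrt hγ.le
  nlinarith

lemma mp_edge_right (hγ : 0 < γ) : (1 + √γ) ^ 2 = (1 + γ) + 2 * √γ := by
  have := Real.sq_sqrt hγ.le
  nlinarith

lemma two_sqrt_le_one_add (hγ : 0 < γ) : 2 * √γ ≤ 1 + γ := by
  have := mp_edge_left hγ
  nlinarith [sq_nonneg (1 - √γ)]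

/-- The density of the absolutely continuous part of the Marchenko–Pastur law. -/
def mpDensity (γ x : ℝ) : ℝ :=
  √(((1 + √γ) ^ 2 - x) * (x - (1 - √γ) ^ 2)) / (2 * Real.pi * γ * x)

/-- Completing the square puts the density in the form of `integral_sqrt_div_add` with `e = 1 + γ`,
`r = 2√γ`, `l = 0`. -/
lemma mpDensity_eq (hγ : 0 < γ) (x : ℝ) :
    mpDensity γ x = (2 * Real.pi * γ)⁻¹ * (√((2 * √γ) ^ 2 - (x - (1 + γ)) ^ 2) / (x + 0)) := by
  rw [mpDensity, mp_edge_left hγ, mp_edge_right hγ,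
    show (1 + γ + 2 * √γ - x) * (x - (1 + γ - 2 * √γ)) = (2 * √γ) ^ 2 - (x - (1 + γ)) ^ 2 by ring]
  rw [add_zero, ← div_div, div_eq_inv_mul, div_eq_inv_mul, div_eq_inv_mul]
  ring

/-- The support interval of the absolutely continuous part of the Marchenko–Pastur law. -/
def mpInterval (γ : ℝ) : Set ℝ := Set.Icc ((1 - √γ) ^ 2) ((1 + √γ) ^ 2)

lemma integrableOn_mpDensity (hγ : 0 < γ) : IntegrableOn (mpDensity γ) (mpInterval γ) := by
  have h := (integral_sqrt_div_add (e := 1 + γ) (r := 2 * √γ) (l := 0) (by positivity)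
    (by linarith [two_sqrt_le_one_add hγ])).1
  rw [mpInterval, mp_edge_left hγ, mp_edge_right hγ]
  have h2 := h.const_mul (2 * Real.pi * γ)⁻¹
  exact h2.congr (by filter_upwards with x using (mpDensity_eq hγ x).symm)

lemma measurable_mpDensity (γ : ℝ) : Measurable (mpDensity γ) := by
  unfold mpDensity; fun_prop

lemma mpDensity_nonneg (hγ : 0 < γ) {x : ℝ} (hx : x ∈ mpInterval γ) : 0 ≤ mpDensity γ x := by
  have : 0 ≤ x := (sq_nonneg _).trans hx.1
  unfold mpDensity
  positivity

lemma marchenkoPastur_eq (γ : ℝ) : marchenkoPastur γ =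
    ENNReal.ofReal (1 - 1 / γ) • Measure.dirac 0 +
      (volume.restrict (mpInterval γ)).withDensity fun x => ENNReal.ofReal (mpDensity γ x) := rfl

lemma isFiniteMeasure_mp_ac (hγ : 0 < γ) : IsFiniteMeasure
    ((volume.restrict (mpInterval γ)).withDensity fun x => ENNReal.ofReal (mpDensity γ x)) :=
  isFiniteMeasure_withDensity_ofReal (integrableOn_mpDensity hγ).2

lemma isFiniteMeasure_marchenkoPastur (hγ : 0 < γ) : IsFiniteMeasure (marchenkoPastur γ) := by
  have := isFiniteMeasure_mp_ac hγ
  have : IsFiniteMeasure (ENNReal.ofReal (1 - 1 / γ) • Measure.dirac (0 : ℝ)) :=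
    Measure.smul_finite _ ENNReal.ofReal_ne_top
  rw [marchenkoPastur_eq]
  infer_instance

lemma ae_nonneg_marchenkoPastur (γ : ℝ) : ∀ᵐ x ∂(marchenkoPastur γ), 0 ≤ x := by
  rw [marchenkoPastur_eq, ae_add_measure_iff]
  constructor
  · exact Measure.ae_smul_measure (by simp [ae_dirac_eq]) _
  · refine (withDensity_absolutelyContinuous _ _).ae_le ?_
    filter_upwards [ae_restrict_mem measurableSet_Icc] with x hx
    exact (sq_nonneg _).trans hx.1

lemma inv_add_pow_le {x l : ℝ} (hx : 0 ≤ x) (hl : 0 < l) (i : ℕ) :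
    |((x + l) ^ i)⁻¹| ≤ (l ^ i)⁻¹ := by
  rw [abs_of_nonneg (by positivity)]
  gcongr
  linarith

lemma integrable_inv_pow_marchenkoPastur (hγ : 0 < γ) {l : ℝ} (hl : 0 < l) (i : ℕ) :
    Integrable (fun x => ((x + l) ^ i)⁻¹) (marchenkoPastur γ) := by
  have := isFiniteMeasure_marchenkoPastur hγ
  refine Integrable.of_bound (Measurable.aestronglyMeasurable (by fun_prop)) (l ^ i)⁻¹ ?_
  filter_upwards [ae_nonneg_marchenkoPastur γ] with x hx using inv_add_pow_le hx hl i

/-- The counterpart for the limit law of `abs_trace_diffQuot_sub_frobSq_le`, with the same pointwise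
algebra; only finiteness of the total mass enters. -/
lemma abs_diffQuot_mpTheta_sub_le (hγ : 0 < γ) {l h : ℝ} (hl : 0 < l) (hh : 0 < h) :
    |(mpTheta 1 γ l - mpTheta 1 γ (l + h)) / h - mpTheta 2 γ l| ≤
      (marchenkoPastur γ).real Set.univ * l⁻¹ ^ 3 * h := by
  have := isFiniteMeasure_marchenkoPastur hγ
  have i1 := integrable_inv_pow_marchenkoPastur hγ hl 1
  have i2 := integrable_inv_pow_marchenkoPastur hγ (add_pos hl hh) 1
  have i3 := integrable_inv_pow_marchenkoPastur hγ hl 2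
  have i4 : Integrable (fun x => (((x + l) ^ 1)⁻¹ - ((x + (l + h)) ^ 1)⁻¹) / h)
    (marchenkoPastur γ) := (i1.sub i2).div_const h
  rw [mpTheta, mpTheta, mpTheta, ← integral_sub i1 i2, ← integral_div, ← integral_sub i4 i3]
  have hb := norm_integral_le_of_norm_le_const (μ := marchenkoPastur γ) (C := l⁻¹ ^ 3 * h)
    (f := fun x => (((x + l) ^ 1)⁻¹ - ((x + (l + h)) ^ 1)⁻¹) / h - ((x + l) ^ 2)⁻¹)
    (by
      filter_upwards [ae_nonneg_marchenkoPastur γ] with x hx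
      have h1 : 0 < x + l := by linarith
      have h2 : 0 < x + (l + h) := by linarith
      have e : (((x + l) ^ 1)⁻¹ - ((x + (l + h)) ^ 1)⁻¹) / h - ((x + l) ^ 2)⁻¹ =
          -(h * (((x + l) ^ 2)⁻¹ * ((x + (l + h)) ^ 1)⁻¹)) := by
        field_simp; ring
      rw [e, norm_neg, Real.norm_eq_abs, abs_mul, abs_of_pos hh, abs_mul, mul_comm]
      refine mul_le_mul_of_nonneg_right ?_ hh.le
      have b1 := inv_add_pow_le hx hl 2
      have b2 := inv_add_pow_le hx (add_pos hl hh) 1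
      have b3 : ((l + h) ^ 1)⁻¹ ≤ l⁻¹ := by rw [pow_one]; gcongr; linarith
      calc _ ≤ (l ^ 2)⁻¹ * l⁻¹ := mul_le_mul b1 (b2.trans b3) (abs_nonneg _) (by positivity)
        _ = _ := by field_simp)
  refine hb.trans (le_of_eq ?_)
  ring

/-- The Stieltjes transform of the Marchenko–Pastur law on the negative real axis. -/
lemma mpTheta_one_eq (hγ : 0 < γ) {l : ℝ} (hl : 0 < l) :
    mpTheta 1 γ l = (√((l + 1 - γ) ^ 2 + 4 * l * γ) - (l + 1 - γ)) / (2 * l * γ) := by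
  have := isFiniteMeasure_mp_ac hγ
  have i1 := integrable_inv_pow_marchenkoPastur hγ hl 1
  rw [marchenkoPastur_eq, integrable_add_measure] at i1
  rw [mpTheta, marchenkoPastur_eq, integral_add_measure i1.1 i1.2, integral_smul_measure,
    integral_dirac, integral_withDensity_eq_integral_toReal_smul
      (measurable_mpDensity γ).ennreal_ofReal
      (by filter_upwards with x using ENNReal.ofReal_lt_top)]
  have hr : 0 < 2 * √γ := by positivity
  have hr2 : (2 * √γ) ^ 2 = 4 * γ := by rw [mul_pow, Real.sq_sqrt hγ.le]; norm_num
  obtain ⟨j1, j2⟩ := integral_sqrt_div_add (e := 1 + γ) (r := 2 * √γ) (l := 0) hr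
    (by linarith [two_sqrt_le_one_add hγ])
  obtain ⟨k1, k2⟩ := integral_sqrt_div_add (e := 1 + γ) (r := 2 * √γ) (l := l) hr
    (by linarith [two_sqrt_le_one_add hγ])
  have hI : mpInterval γ = Set.Icc (1 + γ - 2 * √γ) (1 + γ + 2 * √γ) := by
    rw [mpInterval, mp_edge_left hγ, mp_edge_right hγ]
  have hne : ∀ᵐ x ∂(volume.restrict (mpInterval γ)), x ≠ 0 :=
    ae_restrict_of_ae (by simp [ae_iff])
  -- Partial fractions for `1/(x(x + l))` reduce the integral to the shifts `0` and `l`. The point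
  -- `x = 0`, which lies in the support when `γ = 1`, is null.
  have e : ∫ x in mpInterval γ, (ENNReal.ofReal (mpDensity γ x)).toReal • ((x + l) ^ 1)⁻¹ =
      ∫ x in mpInterval γ, (2 * Real.pi * γ * l)⁻¹ *
        (√((2 * √γ) ^ 2 - (x - (1 + γ)) ^ 2) / (x + 0) -
          √((2 * √γ) ^ 2 - (x - (1 + γ)) ^ 2) / (x + l)) := by
    refine integral_congr_ae ?_
    filter_upwards [hne, ae_restrict_mem measurableSet_Icc] with x hx hxm
    have hx0 : 0 ≤ x := (sq_nonneg _).trans hxm.1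
    have hxl : x + l ≠ 0 := by positivity
    rw [ENNReal.toReal_ofReal (mpDensity_nonneg hγ hxm), mpDensity_eq hγ, smul_eq_mul, pow_one,
      add_zero]
    have := Real.pi_pos
    field_simp
    ring
  rw [e, integral_const_mul, hI, integral_sub j1 k1, j2, k2, hr2]
  have e1 : (1 + γ + 0) ^ 2 - 4 * γ = (1 - γ) ^ 2 := by ring
  have e2 : (1 + γ + l) ^ 2 - 4 * γ = (l + 1 - γ) ^ 2 + 4 * l * γ := by ring
  rw [e1, e2, Real.sqrt_sq_eq_abs]
  have := Real.pi_pos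
  -- The shift `0` contributes `|1 - γ|`. For `γ ≥ 1` the atom's `(1 - 1/γ)/l` compensates the
  -- change of sign, so one formula serves both cases.
  rcases le_total γ 1 with h | h
  · rw [abs_of_nonneg (by linarith), ENNReal.ofReal_of_nonpos]
    · simp only [ENNReal.toReal_zero, zero_smul, zero_add]
      field_simp
      ring
    · rw [sub_nonpos, le_div_iff₀ hγ]; linarith
  · rw [abs_of_nonpos (by linarith), ENNReal.toReal_ofReal]
    · simp only [zero_add, pow_one, smul_eq_mul]
      field_simp
      ring
    · rw [sub_nonneg, div_le_iff₀ hγ]; linarith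

end MarchenkoPastur

/-! ### Limits of the expected trace and squared Frobenius norm. -/

section Limits

lemma mpTheta_one_quadratic {γ l : ℝ} (hγ : 0 < γ) (hl : 0 < l) :
    l * γ * mpTheta 1 γ l ^ 2 + (l + 1 - γ) * mpTheta 1 γ l - 1 = 0 := by
  rw [mpTheta_one_eq hγ hl]
  have h := Real.sq_sqrt (show 0 ≤ (l + 1 - γ) ^ 2 + 4 * l * γ by positivity)
  set s := √((l + 1 - γ) ^ 2 + 4 * l * γ)
  have hlγ : 0 < l * γ := by positivity
  field_simp
  nlinarith

lemma mpTheta_one_pos {γ l : ℝ} (hγ : 0 < γ) (hl : 0 < l) : 0 < mpTheta 1 γ l := by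
  rw [mpTheta_one_eq hγ hl]
  have hlγ : 0 < l * γ := by positivity
  have : l + 1 - γ < √((l + 1 - γ) ^ 2 + 4 * l * γ) :=
    Real.lt_sqrt_of_sq_lt (by nlinarith)
  exact div_pos (by linarith) (by positivity)

/-- Stability of the self-consistent equation: an approximate nonnegative solution is close to the
exact one. -/
lemma abs_sub_le_of_approx_root {lam γ ξ a b x y δ : ℝ} (hlam : 0 < lam) (hγ : 0 < γ)
    (hy : 0 < y) (hroot : (γ - lam * y) * (1 + y) - ξ * y = 0) (hx : 0 ≤ x)
    (h : |a - lam * x - b * (x / (1 + x))| ≤ δ) :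
    |x - y| ≤ y / γ * ((δ + |a - γ| + |b - ξ|) * (1 + x)) := by
  -- The roots of this quadratic have product `-γ/lam`, so the other root is `-γ/(lam y)`; the
  -- cofactor of `x - y` is at least `γ/y` when `x ≥ 0`.
  have h1 : (γ - lam * x) * (1 + x) - ξ * x = -((x - y) * (lam * x + γ / y)) := by
    have e : γ / y = lam * y + (ξ + lam - γ) := by
      rw [div_eq_iff hy.ne']; linarith
    rw [e]; linear_combination hroot
  have h2 : |(γ - lam * x) * (1 + x) - ξ * x| ≤ (δ + |a - γ| + |b - ξ|) * (1 + x) := by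
    have e : (γ - lam * x) * (1 + x) - ξ * x =
        (a - lam * x - b * (x / (1 + x))) * (1 + x) - (a - γ) * (1 + x) + (b - ξ) * x := by
      have : (1 + x) ≠ 0 := by positivity
      field_simp; ring
    rw [e]
    refine (abs_add_le _ _).trans ?_
    rw [add_mul (δ + |a - γ|)]
    refine add_le_add ((abs_sub _ _).trans ?_) ?_
    · rw [abs_mul, abs_mul, abs_of_nonneg (by positivity : 0 ≤ 1 + x), ← add_mul]
      gcongr
    · rw [abs_mul, abs_of_nonneg hx]
      gcongr
      linarith
  rw [h1, abs_neg, abs_mul, abs_of_pos (by positivity : 0 < lam * x + γ / y)] at h2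
  have h3 : |x - y| * (γ / y) ≤ |x - y| * (lam * x + γ / y) := by
    gcongr
    nlinarith
  calc |x - y| = y / γ * (|x - y| * (γ / y)) := by field_simp
    _ ≤ _ := mul_le_mul_of_nonneg_left (h3.trans h2) (by positivity)

variable {n p m : ℕ → ℕ} {γ ξ lam : ℝ}

lemma tendsto_sqrt_div {u n : ℕ → ℕ} {a : ℝ}
    (hn : Tendsto n atTop atTop) (hu : Tendsto (fun k => (u k : ℝ) / n k) atTop (𝓝 a)) (c : ℝ) :
    Tendsto (fun k => √(c * u k) / n k) atTop (𝓝 0) := by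
  have hn' : Tendsto (fun k => (n k : ℝ)) atTop atTop := tendsto_natCast_atTop_atTop.comp hn
  have h1 : Tendsto (fun k => √(c * ((u k : ℝ) / n k) * (n k : ℝ)⁻¹)) atTop (𝓝 √(c * a * 0)) :=
    ((hu.const_mul c).mul (tendsto_inv_atTop_zero.comp hn')).sqrt
  rw [mul_zero, Real.sqrt_zero] at h1
  refine h1.congr fun k => ?_
  have e : c * ((u k : ℝ) / n k) * (n k : ℝ)⁻¹ = c * u k / (n k : ℝ) ^ 2 := by
    rw [div_eq_mul_inv, div_eq_mul_inv, sq, mul_inv]; ring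
  rw [e, Real.sqrt_div' _ (sq_nonneg _), Real.sqrt_sq (Nat.cast_nonneg _)]

/-- The normalized expected trace of the resolvent converges to the Stieltjes transform of the
Marchenko–Pastur law. -/
lemma tendsto_expTrace_div (hγ : 0 < γ) (hξ : 0 < ξ) (hlam : 0 < lam)
    (hn : Tendsto n atTop atTop)
    (hpn : Tendsto (fun k => (p k : ℝ) / (n k : ℝ)) atTop (𝓝 γ))
    (hmn : Tendsto (fun k => (m k : ℝ) / (n k : ℝ)) atTop (𝓝 ξ)) :
    Tendsto (fun k => expTrace (m k) (Fin (p k)) (1 / (n k : ℝ)) lam / p k) atTop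
      (𝓝 (mpTheta 1 (γ / ξ) (lam / ξ) / ξ)) := by
  set s := mpTheta 1 (γ / ξ) (lam / ξ) with hs
  have hs0 : 0 < s := mpTheta_one_pos (by positivity) (by positivity)
  have hsq := mpTheta_one_quadratic (γ := γ / ξ) (l := lam / ξ) (by positivity) (by positivity)
  rw [← hs] at hsq
  -- The limit of `E tr R / n`: scaling by `1/n` instead of `1/m` multiplies the Gram matrix by
  -- about `ξ`, giving `s/ξ` per dimension, and `p/n → γ`.
  set y := γ / ξ * s with hy
  have hy0 : 0 < y := by positivity
  have hroot : (γ - lam * y) * (1 + y) - ξ * y = 0 := by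
    have e : (γ - lam * y) * (1 + y) - ξ * y =
        -γ * (lam / ξ * (γ / ξ) * s ^ 2 + (lam / ξ + 1 - γ / ξ) * s - 1) := by
      rw [hy]; field_simp; ring
    rw [e, hsq, mul_zero]
  set t : ℕ → ℝ := fun k => expTrace (m k) (Fin (p k)) (1 / (n k : ℝ)) lam with ht
  have ht0 : ∀ k, 0 ≤ t k := fun k => expTrace_nonneg _ hlam (by positivity)
  -- The error of the self-consistent equation after division by `n`; the factor `1` in the last
  -- root matches `tendsto_sqrt_div`.
  set δ : ℕ → ℝ := fun k => (m k : ℝ) / n k *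
    ((√(2 * p k) / n k + 1 / n k + √(1 * m k) / n k) * lam⁻¹) with hδ
  have hn' : Tendsto (fun k => (n k : ℝ)) atTop atTop := tendsto_natCast_atTop_atTop.comp hn
  have hδ0 : Tendsto δ atTop (𝓝 0) := by
    have h1 := ((((tendsto_sqrt_div hn hpn 2).add
      (tendsto_const_nhds (x := (1:ℝ)).div_atTop hn')).add
        (tendsto_sqrt_div hn hmn 1)).mul_const lam⁻¹)
    have := hmn.mul h1
    simpa [hδ] using this
  have happ : ∀ᶠ k in atTop, |t k / n k - y| ≤ y / γ * ((δ k + |(p k : ℝ) / n k - γ| +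
      |(m k : ℝ) / n k - ξ|) * (1 + (p k : ℝ) / n k * lam⁻¹)) := by
    filter_upwards [hn'.eventually_gt_atTop 0] with k hk
    have h := abs_expTrace_selfConsistent_le (κ := Fin (p k)) (m k) (c := 1 / (n k : ℝ)) hlam
      (by positivity)
    have htle := expTrace_le (κ := Fin (p k)) (m k) (c := 1 / (n k : ℝ)) hlam (by positivity)
    simp only [Fintype.card_fin] at h htle
    have hx0 : 0 ≤ t k / n k := div_nonneg (ht0 k) hk.le
    -- This a priori bound keeps the factor `1 + x` of the stability estimate bounded.
    have hxle : t k / n k ≤ (p k : ℝ) / n k * lam⁻¹ := by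
      rw [div_mul_eq_mul_div]; gcongr
    have h2 : |(p k : ℝ) / n k - lam * (t k / n k) -
        (m k : ℝ) / n k * ((t k / n k) / (1 + t k / n k))| ≤ δ k := by
      have e : (p k : ℝ) / n k - lam * (t k / n k) -
          (m k : ℝ) / n k * ((t k / n k) / (1 + t k / n k)) =
          (p k - lam * t k - m k * (1 / (n k : ℝ) * t k / (1 + 1 / (n k : ℝ) * t k))) / n k := by
        rw [show 1 / (n k : ℝ) * t k = t k / n k by ring]; ring
      rw [e, abs_div, abs_of_pos hk, div_le_iff₀ hk]
      refine h.trans (le_of_eq ?_)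
      simp only [hδ, one_mul]
      field_simp
    refine (abs_sub_le_of_approx_root hlam hγ hy0 hroot hx0 h2).trans ?_
    have hδk : 0 ≤ δ k := by simp only [hδ]; positivity
    gcongr
  have hlim : Tendsto (fun k => t k / n k) atTop (𝓝 y) := by
    rw [tendsto_iff_norm_sub_tendsto_zero]
    refine squeeze_zero' (Eventually.of_forall fun _ => norm_nonneg _) happ ?_
    have h1 : Tendsto (fun k => |(p k : ℝ) / n k - γ|) atTop (𝓝 0) := by
      simpa using (hpn.sub_const γ).abs
    have h2 : Tendsto (fun k => |(m k : ℝ) / n k - ξ|) atTop (𝓝 0) := by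
      simpa using (hmn.sub_const ξ).abs
    have := ((((hδ0.add h1).add h2).mul ((hpn.mul_const lam⁻¹).const_add 1)).const_mul (y / γ))
    simpa using this
  have := hlim.div hpn hγ.ne'
  have e : y / γ = s / ξ := by rw [hy]; field_simp
  rw [e] at this
  refine this.congr' ?_
  filter_upwards [hn'.eventually_gt_atTop 0] with k hk
  simp only [Pi.div_apply]
  rw [div_div_div_cancel_right₀ hk.ne']

/-- If difference quotients approximate `g` uniformly, pointwise convergence transfers from `f`
to `g`. -/
lemma tendsto_of_diffQuot {f : ℕ → ℝ → ℝ} {g : ℕ → ℝ} {F : ℝ → ℝ} {G x C D : ℝ}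
    (hf : ∀ h, 0 ≤ h → Tendsto (fun k => f k (x + h)) atTop (𝓝 (F (x + h))))
    (hg : ∀ h, 0 < h → ∀ᶠ k in atTop, |(f k x - f k (x + h)) / h - g k| ≤ C * h)
    (hG : ∀ h, 0 < h → |(F x - F (x + h)) / h - G| ≤ D * h) :
    Tendsto g atTop (𝓝 G) := by
  rw [Metric.tendsto_atTop']
  intro ε hε
  -- The step is fixed first, so that the two approximation errors total less than `ε/2`; only then
  -- does `k` grow.
  set h := ε / (2 * (|C| + |D| + 1)) with hh
  have hpos : 0 < |C| + |D| + 1 := by positivity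
  have h0 : 0 < h := by positivity
  have hsmall : C * h + D * h < ε / 2 := by
    have : (|C| + |D| + 1) * h = ε / 2 := by rw [hh]; field_simp
    nlinarith [le_abs_self C, le_abs_self D]
  have hq : Tendsto (fun k => (f k x - f k (x + h)) / h) atTop (𝓝 ((F x - F (x + h)) / h)) := by
    have := hf 0 le_rfl
    simp only [add_zero] at this
    exact (this.sub (hf h h0.le)).div_const h
  have hev := (Metric.tendsto_nhds.1 hq (ε / 2) (by positivity)).and (hg h h0)
  rw [eventually_atTop] at hev
  obtain ⟨N, hN⟩ := hev
  refine ⟨N, fun k hk => ?_⟩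
  obtain ⟨h1, h2⟩ := hN k hk.le
  have h3 := hG h h0
  rw [Real.dist_eq] at h1 ⊢
  rw [abs_lt] at *
  rw [abs_le] at h2 h3
  constructor <;> linarith [h1.1, h1.2, h2.1, h2.2, h3.1, h3.2]

/-- The normalized expected squared Frobenius norm of the resolvent converges to the second
resolvent moment of the Marchenko–Pastur law. -/
lemma tendsto_expFrobSq_div (hγ : 0 < γ) (hξ : 0 < ξ) (hlam : 0 < lam)
    (hn : Tendsto n atTop atTop) (hp : Tendsto p atTop atTop)
    (hpn : Tendsto (fun k => (p k : ℝ) / (n k : ℝ)) atTop (𝓝 γ))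
    (hmn : Tendsto (fun k => (m k : ℝ) / (n k : ℝ)) atTop (𝓝 ξ)) :
    Tendsto (fun k => expFrobSq (m k) (Fin (p k)) (1 / (n k : ℝ)) lam / p k) atTop
      (𝓝 (mpTheta 2 (γ / ξ) (lam / ξ) / ξ ^ 2)) := by
  have hγξ : 0 < γ / ξ := by positivity
  refine tendsto_of_diffQuot
    (f := fun k x => expTrace (m k) (Fin (p k)) (1 / (n k : ℝ)) x / p k)
    (F := fun x => mpTheta 1 (γ / ξ) (x / ξ) / ξ) (x := lam) (C := lam⁻¹ ^ 3)
    (D := (marchenkoPastur (γ / ξ)).real Set.univ * (lam / ξ)⁻¹ ^ 3 / ξ ^ 3)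
    (fun h hh => tendsto_expTrace_div hγ hξ (by positivity) hn hpn hmn) ?_ ?_
  · intro h hh
    filter_upwards [hp.eventually_gt_atTop 0] with k hk
    have hk' : (0 : ℝ) < p k := by exact_mod_cast hk
    have := abs_diffQuot_expTrace_sub_expFrobSq_le (κ := Fin (p k)) (m k) (c := 1 / (n k : ℝ))
      hlam (by positivity) hh
    rw [Fintype.card_fin] at this
    have e : ∀ a b d : ℝ, (a / p k - b / p k) / h - d / p k = ((a - b) / h - d) / p k := by
      intro a b d; ring
    rw [e, abs_div, abs_of_pos hk', div_le_iff₀ hk']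
    linarith
  · intro h hh
    -- Since `mpTheta` is evaluated at `x/ξ`, a step `h` in `x` becomes `h/ξ`, which accounts for
    -- the powers of `ξ` in `D`.
    have := abs_diffQuot_mpTheta_sub_le hγξ (l := lam / ξ) (h := h / ξ) (by positivity)
      (by positivity)
    rw [← add_div] at this
    have e : ∀ a b d : ℝ, (a / ξ - b / ξ) / h - d / ξ ^ 2 = ((a - b) / (h / ξ) - d) / ξ ^ 2 := by
      intro a b d; field_simp
    rw [e, abs_div, abs_of_pos (by positivity : 0 < ξ ^ 2), div_le_iff₀ (by positivity)]
    refine this.trans (le_of_eq ?_)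
    field_simp

end Limits

/-! ### Exact first and second moments of Wishart matrices. -/

section WishartMoments

set_option linter.unusedSectionVars false

variable {ι κ ν : Type*} [Fintype ι] [Fintype κ] [Fintype ν] [DecidableEq κ]

lemma integral_sub_const_sq {Ω : Type*} [MeasurableSpace Ω] {μ : Measure Ω}
    [IsProbabilityMeasure μ] {f : Ω → ℝ} (hf : MemLp f 2 μ) (a : ℝ) :
    ∫ x, (f x - a) ^ 2 ∂μ = Var[f; μ] + (∫ x, f x ∂μ - a) ^ 2 := by
  have h1 : Integrable f μ := hf.integrable one_le_two
  have h2 : Integrable (fun x => f x ^ 2) μ := hf.integrable_sq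
  rw [variance_eq_sub hf]
  have e : ∀ x, (f x - a) ^ 2 = f x ^ 2 - (2 * a * f x - a ^ 2) := fun x => by ring
  simp only [e]
  have h3 : Integrable (fun x => 2 * a * f x - a ^ 2) μ :=
    (h1.const_mul _).sub (integrable_const _)
  rw [integral_sub h2 h3,
    integral_sub (h1.const_mul _) (integrable_const _), integral_const_mul]
  simp only [Pi.pow_apply, integral_const, probReal_univ, smul_eq_mul, one_mul]
  ring

lemma mul_scaledGram_apply (K : Matrix ν κ ℝ) (c : ℝ) (W : ι → κ → ℝ) (i : ν) (j : κ) :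
    (K * scaledGram c W) i j = ∑ k, c * ((K i ⬝ᵥ W k) * W k j) := by
  simp only [Matrix.mul_apply, scaledGram_apply, dotProduct, Finset.mul_sum, Finset.sum_mul]
  rw [Finset.sum_comm]
  exact Finset.sum_congr rfl fun k _ => Finset.sum_congr rfl fun b _ => by ring

lemma integral_eval_gaussianMat {f : (κ → ℝ) → ℝ} (hf : MemLp f 2 (gaussianVec κ)) (k : ι) :
    ∫ W, f (W k) ∂(gaussianMat ι κ) = ∫ w, f w ∂(gaussianVec κ) :=
  integral_comp_eval hf.1

lemma memLp_comp_eval_gaussianMat {f : (κ → ℝ) → ℝ} (hf : MemLp f 2 (gaussianVec κ)) (k : ι) :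
    MemLp (fun W : ι → κ → ℝ => f (W k)) 2 (gaussianMat ι κ) :=
  hf.comp_measurePreserving (measurePreserving_eval _ k)

/-- A second moment identity for Wishart matrices. -/
lemma integral_frobSq_mul_scaledGram_sub (K : Matrix ν κ ℝ) (c lam : ℝ) :
    ∫ W, frobSq (K * scaledGram c W - lam • K) ∂(gaussianMat ι κ) =
      ((c * Fintype.card ι - lam) ^ 2 + c ^ 2 * Fintype.card ι * (Fintype.card κ + 1)) *
        frobSq K := by
  have hm : ∀ i j, MemLp (fun w => c * ((K i ⬝ᵥ w) * w j)) 2 (gaussianVec κ) := fun i j =>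
    (memLp_dotProduct_mul_gaussianVec (K i) j).const_mul c
  have hM : ∀ i j, MemLp (fun W : ι → κ → ℝ => ∑ k, c * ((K i ⬝ᵥ W k) * W k j)) 2
      (gaussianMat ι κ) := fun i j =>
    memLp_finsetSum _ fun k _ => memLp_comp_eval_gaussianMat (hm i j) k
  have hentry : ∀ i j, ∫ W, (K * scaledGram c W - lam • K) i j ^ 2 ∂(gaussianMat ι κ) =
      c ^ 2 * Fintype.card ι * (K i ⬝ᵥ K i + K i j ^ 2) +
        (c * Fintype.card ι - lam) ^ 2 * K i j ^ 2 := by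
    intro i j
    simp only [Matrix.sub_apply, mul_scaledGram_apply, Matrix.smul_apply, smul_eq_mul]
    rw [integral_sub_const_sq (hM i j)]
    -- Each entry is a sum over the rows of `W` of independent, identically distributed terms.
    have hv : Var[fun W : ι → κ → ℝ => ∑ k, c * ((K i ⬝ᵥ W k) * W k j); gaussianMat ι κ] =
        c ^ 2 * Fintype.card ι * (K i ⬝ᵥ K i + K i j ^ 2) := by
      have h := variance_sum_pi (ι := ι) (μ := fun _ => gaussianVec κ)
        (X := fun _ w => c * ((K i ⬝ᵥ w) * w j)) fun _ => hm i j
      have e : (∑ k, fun W : ι → κ → ℝ => c * ((K i ⬝ᵥ W k) * W k j)) =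
          fun W => ∑ k, c * ((K i ⬝ᵥ W k) * W k j) := by
        funext W; simp
      rw [e] at h
      rw [h]
      simp only [variance_const_mul, variance_dotProduct_mul_gaussianVec, Finset.sum_const,
        Finset.card_univ, nsmul_eq_mul]
      ring
    have he : ∫ W, ∑ k, c * ((K i ⬝ᵥ W k) * W k j) ∂(gaussianMat ι κ) =
        Fintype.card ι * (c * K i j) := by
      rw [integral_finsetSum _ fun k _ =>
        (memLp_comp_eval_gaussianMat (hm i j) k).integrable one_le_two]
      simp only [integral_eval_gaussianMat (hm i j), integral_const_mul,
        integral_dotProduct_mul_gaussianVec, Finset.sum_const, Finset.card_univ, nsmul_eq_mul]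
    rw [hv, he]; ring
  have hint : ∀ i j, Integrable (fun W : ι → κ → ℝ => (K * scaledGram c W - lam • K) i j ^ 2)
      (gaussianMat ι κ) := fun i j => by
    simp only [Matrix.sub_apply, mul_scaledGram_apply, Matrix.smul_apply, smul_eq_mul]
    exact ((hM i j).sub (memLp_const _)).integrable_sq
  simp only [frobSq]
  rw [integral_finsetSum _ fun i _ => integrable_finsetSum _ fun j _ => hint i j]
  simp only [integral_finsetSum _ fun j _ => hint _ j, hentry]
  rw [Finset.mul_sum]
  refine Finset.sum_congr rfl fun i _ => ?_
  -- Summed over `j`, the term `‖Kᵢ‖²` counts `card κ` times and `Kᵢⱼ²` once more, whence the factor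
  -- `card κ + 1`.
  have e : K i ⬝ᵥ K i = ∑ j, K i j ^ 2 := by simp [dotProduct, sq]
  simp only [mul_add, Finset.sum_add_distrib, ← Finset.mul_sum, Finset.sum_const,
    Finset.card_univ, nsmul_eq_mul, e]
  ring

lemma trace_mul_scaledGram_mul_transpose (K : Matrix ν κ ℝ) (c : ℝ) (W : ι → κ → ℝ) :
    (K * scaledGram c W * Kᵀ).trace = ∑ i, ∑ k, c * (K i ⬝ᵥ W k) ^ 2 := by
  simp only [Matrix.trace, Matrix.diag]
  refine Finset.sum_congr rfl fun i _ => ?_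
  rw [Matrix.mul_apply]
  simp only [mul_scaledGram_apply, Matrix.transpose_apply, Finset.sum_mul]
  rw [Finset.sum_comm]
  refine Finset.sum_congr rfl fun k _ => ?_
  have : K i ⬝ᵥ W k = ∑ j, K i j * W k j := rfl
  rw [sq]; nth_rewrite 3 [this]
  rw [Finset.mul_sum, Finset.mul_sum]
  exact Finset.sum_congr rfl fun j _ => by ring

lemma integrable_dotProduct_sq_gaussianVec (u : κ → ℝ) :
    Integrable (fun w => (u ⬝ᵥ w) ^ 2) (gaussianVec κ) := by
  have h : MemLp (fun w => u ⬝ᵥ w) 2 (gaussianVec κ) := by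
    have h1 : ∀ i, MemLp (fun w : κ → ℝ => u i * w i) 2 (gaussianVec κ) := fun i =>
      (memLp_eval_gaussianVec i 2).const_mul (u i)
    exact memLp_finsetSum Finset.univ fun i _ => h1 i
  exact h.integrable_sq

lemma integral_trace_mul_scaledGram_mul_transpose (K : Matrix ν κ ℝ) (c : ℝ) :
    Integrable (fun W => (K * scaledGram c W * Kᵀ).trace) (gaussianMat ι κ) ∧
    ∫ W, (K * scaledGram c W * Kᵀ).trace ∂(gaussianMat ι κ) =
      c * Fintype.card ι * frobSq K := by
  have hint : ∀ (i : ν) (k : ι), Integrable (fun W : ι → κ → ℝ => c * (K i ⬝ᵥ W k) ^ 2)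
      (gaussianMat ι κ) := fun i k =>
    ((measurePreserving_eval (fun _ : ι => gaussianVec κ) k).integrable_comp_of_integrable
      (integrable_dotProduct_sq_gaussianVec (K i))).const_mul c
  simp only [trace_mul_scaledGram_mul_transpose]
  refine ⟨integrable_finsetSum _ fun i _ => integrable_finsetSum _ fun k _ => hint i k, ?_⟩
  rw [integral_finsetSum _ fun i _ => integrable_finsetSum _ fun k _ => hint i k]
  simp only [integral_finsetSum _ fun k _ => hint _ k, integral_const_mul]
  have : ∀ (i : ν) (k : ι), ∫ W, (K i ⬝ᵥ W k) ^ 2 ∂(gaussianMat ι κ) = K i ⬝ᵥ K i := fun i k => by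
    rw [← integral_dotProduct_sq_gaussianVec]
    exact integral_comp_eval (μ := fun _ : ι => gaussianVec κ) (f := fun w => (K i ⬝ᵥ w) ^ 2)
      (integrable_dotProduct_sq_gaussianVec (K i)).1
  simp only [this, Finset.sum_const, Finset.card_univ, nsmul_eq_mul]
  rw [frobSq, Finset.mul_sum]
  refine Finset.sum_congr rfl fun i _ => ?_
  simp only [dotProduct, sq]
  ring

end WishartMoments

/-! ### Reduction of the sketched model to two independent Gaussian blocks. -/

section SketchedMatrices

set_option linter.unusedSectionVars false

variable {ι ι' κ ν : Type*} [Fintype ι] [Fintype ι'] [Fintype κ] [Fintype ν] [DecidableEq κ]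

/-- The matrix mapping the coefficients to the bias of the sketched ridge estimator, in terms of
the sketched design `Y` and the design `X`. -/
def biasMatrix (c lam : ℝ) (Y : ι → κ → ℝ) (X : ν → κ → ℝ) : Matrix κ κ ℝ :=
  ridgeResolvent lam (scaledGram c Y) * scaledGram c X - 1

/-- The matrix mapping the response to the sketched ridge estimator, in terms of the sketched
design `Y` and the design `X`. -/
def noiseMatrix (c lam : ℝ) (Y : ι → κ → ℝ) (X : ν → κ → ℝ) : Matrix κ ν ℝ :=
  c • (ridgeResolvent lam (scaledGram c Y) * (Matrix.of X)ᵀ)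

lemma frobSq_noiseMatrix (c lam : ℝ) (Y : ι → κ → ℝ) (X : ν → κ → ℝ) :
    frobSq (noiseMatrix c lam Y X) = c * (ridgeResolvent lam (scaledGram c Y) * scaledGram c X *
      (ridgeResolvent lam (scaledGram c Y))ᵀ).trace := by
  rw [trace_mul_scaledGram_mul_transpose, frobSq, Finset.mul_sum]
  refine Finset.sum_congr rfl fun i _ => ?_
  rw [Finset.mul_sum]
  refine Finset.sum_congr rfl fun k _ => ?_
  simp only [noiseMatrix, Matrix.smul_apply, smul_eq_mul, Matrix.mul_apply, Matrix.transpose_apply,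
    Matrix.of_apply, dotProduct]
  ring

lemma memLp_biasMatrix_apply {Ω : Type*} [MeasurableSpace Ω] {μ : Measure Ω} [IsFiniteMeasure μ]
    {c lam : ℝ} (hc : 0 ≤ c) (hlam : 0 < lam) {Y : Ω → ι → κ → ℝ} {X : Ω → ν → κ → ℝ}
    (hY : Measurable Y) (hX : ∀ a i, MemLp (fun ω => X ω a i) 4 μ) (i j : κ) :
    MemLp (fun ω => biasMatrix c lam (Y ω) (X ω) i j) 2 μ := by
  simp only [biasMatrix, Matrix.sub_apply, Matrix.mul_apply]
  refine MemLp.sub (memLp_finsetSum _ fun k _ => ?_) (memLp_const _)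
  have h1 : MemLp (fun ω => scaledGram c (X ω) k j) 2 μ := by
    simp only [scaledGram_apply]
    exact (memLp_finsetSum _ fun a _ => memLp_four_mul (hX a k) (hX a j)).const_mul c
  have h2 : MemLp (fun ω => ridgeResolvent lam (scaledGram c (Y ω)) i k) ⊤ μ :=
    memLp_top_of_bound (measurable_ridgeResolvent (fun a b => measurable_scaledGram hY c a b)
      lam i k).aestronglyMeasurable lam⁻¹ (by
        filter_upwards with ω using
          abs_ridgeResolvent_apply_le hlam (scaledGram_posSemidef hc (Y ω)) i k)
  exact h1.mul' h2

lemma memLp_noiseMatrix_apply {Ω : Type*} [MeasurableSpace Ω] {μ : Measure Ω}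
    {c lam : ℝ} (hc : 0 ≤ c) (hlam : 0 < lam) {Y : Ω → ι → κ → ℝ} {X : Ω → ν → κ → ℝ}
    (hY : Measurable Y) (hX : ∀ a i, MemLp (fun ω => X ω a i) 2 μ) (i : κ) (j : ν) :
    MemLp (fun ω => noiseMatrix c lam (Y ω) (X ω) i j) 2 μ := by
  simp only [noiseMatrix, Matrix.smul_apply, smul_eq_mul, Matrix.mul_apply,
    Matrix.transpose_apply, Matrix.of_apply]
  have h2 : ∀ k, MemLp (fun ω => ridgeResolvent lam (scaledGram c (Y ω)) i k) ⊤ μ :=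
    fun k => memLp_top_of_bound (measurable_ridgeResolvent
      (fun a b => measurable_scaledGram hY c a b)
      lam i k).aestronglyMeasurable lam⁻¹ (by
        filter_upwards with ω using
          abs_ridgeResolvent_apply_le hlam (scaledGram_posSemidef hc (Y ω)) i k)
  have h3 : ∀ k, MemLp (fun ω => ridgeResolvent lam (scaledGram c (Y ω)) i k * X ω j k) 2 μ :=
    fun k => (hX j k).mul' (h2 k)
  exact (memLp_finsetSum Finset.univ fun k _ => h3 k).const_mul c

lemma integrable_frobSq {Ω : Type*} [MeasurableSpace Ω] {μ : Measure Ω} {M : Ω → Matrix κ ν ℝ}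
    (hM : ∀ i j, MemLp (fun ω => M ω i j) 2 μ) : Integrable (fun ω => frobSq (M ω)) μ :=
  integrable_finsetSum _ fun i _ => integrable_finsetSum _ fun j _ => (hM i j).integrable_sq

lemma scaledGram_sumElim (c : ℝ) (W₁ : ι → κ → ℝ) (W₂ : ι' → κ → ℝ) :
    scaledGram c (Sum.elim W₁ W₂) = scaledGram c W₁ + scaledGram c W₂ := by
  ext i j
  simp [scaledGram_apply, Fintype.sum_sum_type, mul_add]

/-- `R` inverts the shifted Gram matrix of `W₁`, so that block of `R XᵀX` cancels the identity up to
`-lam R`; what remains is linear in the Gram matrix of `W₂`. -/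
lemma biasMatrix_sumElim {c lam : ℝ} (hc : 0 ≤ c) (hlam : 0 < lam) (W₁ : ι → κ → ℝ)
    (W₂ : ι' → κ → ℝ) : biasMatrix c lam W₁ (Sum.elim W₁ W₂) =
      ridgeResolvent lam (scaledGram c W₁) * scaledGram c W₂ -
        lam • ridgeResolvent lam (scaledGram c W₁) := by
  rw [biasMatrix, scaledGram_sumElim, Matrix.mul_add,
    ridgeResolvent_mul_self hlam (scaledGram_posSemidef hc W₁)]
  abel

lemma frobSq_noiseMatrix_sumElim {c lam : ℝ} (hc : 0 ≤ c) (hlam : 0 < lam) (W₁ : ι → κ → ℝ)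
    (W₂ : ι' → κ → ℝ) : frobSq (noiseMatrix c lam W₁ (Sum.elim W₁ W₂)) =
      c * ((ridgeResolvent lam (scaledGram c W₁)).trace -
        lam * frobSq (ridgeResolvent lam (scaledGram c W₁)) +
        (ridgeResolvent lam (scaledGram c W₁) * scaledGram c W₂ *
          (ridgeResolvent lam (scaledGram c W₁))ᵀ).trace) := by
  have hps := scaledGram_posSemidef hc W₁
  rw [frobSq_noiseMatrix, scaledGram_sumElim, Matrix.mul_add, ridgeResolvent_mul_self hlam hps,
    Matrix.add_mul, Matrix.trace_add, Matrix.sub_mul, Matrix.one_mul, Matrix.trace_sub,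
    Matrix.trace_transpose, ridgeResolvent_transpose lam hps, frobSq_ridgeResolvent_eq lam hps,
    Matrix.smul_mul, Matrix.trace_smul, smul_eq_mul]

lemma memLp_sumElim_gaussianMat (q : NNReal) (a : ι ⊕ ι') (i : κ) :
    MemLp (fun W : (ι → κ → ℝ) × (ι' → κ → ℝ) => Sum.elim W.1 W.2 a i) q
      ((gaussianMat ι κ).prod (gaussianMat ι' κ)) := by
  rcases a with a | a
  · exact (memLp_eval_gaussianMat a i q).comp_measurePreserving measurePreserving_fst
  · exact (memLp_eval_gaussianMat a i q).comp_measurePreserving measurePreserving_snd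

/-- Integrate over `W₂` first: with `W₁` frozen the resolvent is the constant `K` of the Wishart
identity. -/
lemma integral_prod_frobSq_biasMatrix (m : ℕ) {c lam : ℝ} (hc : 0 ≤ c) (hlam : 0 < lam) :
    ∫ W, frobSq (biasMatrix c lam W.1 (Sum.elim W.1 W.2))
      ∂((gaussianMat (Fin m) κ).prod (gaussianMat ι' κ)) =
    ((c * Fintype.card ι' - lam) ^ 2 + c ^ 2 * Fintype.card ι' * (Fintype.card κ + 1)) *
      expFrobSq m κ c lam := by
  rw [integral_prod _ (integrable_frobSq fun i j => memLp_biasMatrix_apply hc hlam measurable_fst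
    (fun a i => memLp_sumElim_gaussianMat 4 a i) i j)]
  simp only [biasMatrix_sumElim hc hlam, integral_frobSq_mul_scaledGram_sub]
  rw [integral_const_mul, expFrobSq]

lemma integral_prod_frobSq_noiseMatrix (m : ℕ) {c lam : ℝ} (hc : 0 ≤ c) (hlam : 0 < lam) :
    ∫ W, frobSq (noiseMatrix c lam W.1 (Sum.elim W.1 W.2))
      ∂((gaussianMat (Fin m) κ).prod (gaussianMat ι' κ)) =
    c * (expTrace m κ c lam + (c * Fintype.card ι' - lam) * expFrobSq m κ c lam) := by
  rw [integral_prod _ (integrable_frobSq fun i j => memLp_noiseMatrix_apply hc hlam measurable_fst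
    (fun a i => memLp_sumElim_gaussianMat 2 a i) i j)]
  have h : ∀ W₁ : Fin m → κ → ℝ, ∫ W₂, frobSq (noiseMatrix c lam W₁ (Sum.elim W₁ W₂))
      ∂(gaussianMat ι' κ) = c * ((ridgeResolvent lam (scaledGram c W₁)).trace +
        (c * Fintype.card ι' - lam) * frobSq (ridgeResolvent lam (scaledGram c W₁))) := by
    intro W₁
    have h2 := integral_trace_mul_scaledGram_mul_transpose (ι := ι')
      (ridgeResolvent lam (scaledGram c W₁)) c
    simp only [frobSq_noiseMatrix_sumElim hc hlam]
    rw [integral_const_mul, integral_add (integrable_const _) h2.1, h2.2]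
    simp only [integral_const, probReal_univ, smul_eq_mul, one_mul]
    ring
  simp only [h]
  rw [integral_const_mul, integral_add (integrable_trace_ridgeResolvent hlam hc)
    ((integrable_frobSq_ridgeResolvent hlam hc).const_mul _), integral_const_mul, expTrace,
    expFrobSq]

/-- Rows of a matrix expressed in an orthonormal basis have the same Gram matrix. -/
lemma scaledGram_rotate (b : OrthonormalBasis ι ℝ (EuclideanSpace ℝ ν)) (c : ℝ)
    (X : ν → κ → ℝ) :
    scaledGram c (fun i j => (b i).ofLp ⬝ᵥ fun a => X a j) = scaledGram c X := by
  ext i j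
  rw [scaledGram_apply, scaledGram_apply]
  have h := b.sum_inner_mul_inner (WithLp.toLp 2 fun a => X a i) (WithLp.toLp 2 fun a => X a j)
  simp only [EuclideanSpace.inner_eq_star_dotProduct, star_trivial] at h
  have e : ∀ k, (b k).ofLp ⬝ᵥ (fun a => X a i) * ((b k).ofLp ⬝ᵥ fun a => X a j) =
      (b k).ofLp ⬝ᵥ (fun a => X a i) * ((fun a => X a j) ⬝ᵥ (b k).ofLp) := fun k => by
    rw [dotProduct_comm (fun a => X a j)]
  rw [Finset.sum_congr rfl fun k _ => e k, h]
  simp [dotProduct, mul_comm]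

lemma exists_orthonormalBasis_extending_rows {m n N : ℕ} (hN : m + N = n)
    (L : Fin m → Fin n → ℝ) (hL : Matrix.of L * (Matrix.of L)ᵀ = 1) :
    ∃ b : OrthonormalBasis (Fin m ⊕ Fin N) ℝ (EuclideanSpace ℝ (Fin n)),
      ∀ i, (b (Sum.inl i)).ofLp = L i := by
  have hcard : Module.finrank ℝ (EuclideanSpace ℝ (Fin n)) = Fintype.card (Fin m ⊕ Fin N) := by
    simp [hN]
  -- The values `0` are placeholders: the extension only asks for orthonormality on the range of
  -- `Sum.inl`.
  set v : Fin m ⊕ Fin N → EuclideanSpace ℝ (Fin n) :=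
    Sum.elim (fun i => WithLp.toLp 2 (L i)) 0 with hv
  have hort : Orthonormal ℝ ((Set.range Sum.inl).domRestrict v) := by
    rw [orthonormal_iff_ite]
    rintro ⟨_, i, rfl⟩ ⟨_, j, rfl⟩
    have h := congrFun (congrFun hL i) j
    rw [Matrix.mul_apply, Matrix.one_apply] at h
    have h1 : inner ℝ (v (Sum.inl i)) (v (Sum.inl j)) = if i = j then (1 : ℝ) else 0 := by
      rw [← h, hv, Sum.elim_inl, Sum.elim_inl, EuclideanSpace.inner_eq_star_dotProduct,
        star_trivial, dotProduct_comm]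
      rfl
    refine h1.trans ?_
    by_cases hij : i = j
    · subst hij; simp
    · rw [if_neg hij, if_neg fun h => hij (Sum.inl_injective (Subtype.ext_iff.1 h))]
  obtain ⟨b, hb⟩ := hort.exists_orthonormalBasis_extension_of_card_eq hcard
  refine ⟨b, fun i => ?_⟩
  rw [hb _ ⟨i, rfl⟩]
  simp [hv]

/-- Integrals of functions of the Gram matrices of the sketched and the full Gaussian design, for
a fixed sketch with orthonormal rows. -/
lemma integral_gaussianMat_sketch {m n N : ℕ} (hN : m + N = n)
    (L : Fin m → Fin n → ℝ) (hL : Matrix.of L * (Matrix.of L)ᵀ = 1) (c : ℝ)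
    (Φ : (Fin m → κ → ℝ) → Matrix κ κ ℝ → ℝ)
    (hΦ : Measurable fun W : Fin m ⊕ Fin N → κ → ℝ =>
      Φ (fun i => W (Sum.inl i)) (scaledGram c W)) :
    ∫ X : Fin n → κ → ℝ, Φ (Matrix.of L * Matrix.of X) (scaledGram c X)
        ∂(gaussianMat (Fin n) κ) =
      ∫ W, Φ W.1 (scaledGram c (Sum.elim W.1 W.2))
        ∂((gaussianMat (Fin m) κ).prod (gaussianMat (Fin N) κ)) := by
  -- The first `m` rotated rows are exactly `LX`, and by Parseval the full Gram matrix does not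
  -- change.
  obtain ⟨b, hb⟩ := exists_orthonormalBasis_extending_rows hN L hL
  have h1 := integral_comp_measurePreserving
    (measurePreserving_rotate_gaussianMat (κ := κ) b) hΦ.aestronglyMeasurable
  have h2 := integral_comp_measurePreserving
    (measurePreserving_sumPiEquivProdPi_symm
      (fun _ : Fin m ⊕ Fin N => gaussianVec κ)) hΦ.aestronglyMeasurable
  simp only [scaledGram_rotate, hb] at h1
  refine Eq.trans ?_ (h1.trans (h2.symm.trans ?_))
  · rfl
  · refine integral_congr_ae ?_
    filter_upwards with W
    have e : (MeasurableEquiv.sumPiEquivProdPi fun _ : Fin m ⊕ Fin N => κ → ℝ).symm W =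
        Sum.elim W.1 W.2 := by
      funext a
      rcases a with a | a <;> rfl
    rw [e]
    rfl

end SketchedMatrices

/-! ### Random matrices applied to independent uncorrelated vectors. -/

section RandomMatrixVector

/-- Expand the square, factor each expectation by independence, and the off-diagonal terms vanish.
The variances may differ by coordinate so that `β` and `ε` can be stacked. -/
lemma integral_sqNorm_mulVec {Ω κ : Type*} [MeasurableSpace Ω] [Fintype κ] [DecidableEq κ]
    {μ : Measure Ω} {p : ℕ} {T : Ω → Matrix (Fin p) κ ℝ} {v : Ω → κ → ℝ} {s : κ → ℝ}
    (hT : ∀ i j, MemLp (fun ω => T ω i j) 2 μ) (hv : ∀ j, MemLp (fun ω => v ω j) 2 μ)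
    (hind : ∀ i j k, IndepFun (fun ω => T ω i j * T ω i k) (fun ω => v ω j * v ω k) μ)
    (hcov : ∀ j k, ∫ ω, v ω j * v ω k ∂μ = if j = k then s j else 0) :
    Integrable (fun ω => sqNorm (T ω *ᵥ v ω)) μ ∧
    ∫ ω, sqNorm (T ω *ᵥ v ω) ∂μ = ∑ i, ∑ j, s j * ∫ ω, T ω i j ^ 2 ∂μ := by
  have hTT : ∀ i j k, Integrable (fun ω => T ω i j * T ω i k) μ := fun i j k =>
    (hT i j).integrable_mul (hT i k)
  have hvv : ∀ j k, Integrable (fun ω => v ω j * v ω k) μ := fun j k =>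
    (hv j).integrable_mul (hv k)
  have hint : ∀ i j k, Integrable (fun ω => T ω i j * T ω i k * (v ω j * v ω k)) μ :=
    fun i j k => (hind i j k).integrable_mul (hTT i j k) (hvv j k)
  have e : ∀ ω, sqNorm (T ω *ᵥ v ω) =
      ∑ i, ∑ j, ∑ k, T ω i j * T ω i k * (v ω j * v ω k) := by
    intro ω
    simp only [sqNorm, Matrix.mulVec, dotProduct, sq, Finset.sum_mul_sum]
    exact Finset.sum_congr rfl fun i _ => Finset.sum_congr rfl fun j _ =>
      Finset.sum_congr rfl fun k _ => by ring
  simp only [e]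
  refine ⟨integrable_finsetSum _ fun i _ => integrable_finsetSum _ fun j _ =>
    integrable_finsetSum _ fun k _ => hint i j k, ?_⟩
  rw [integral_finsetSum _ fun i _ => integrable_finsetSum _ fun j _ =>
    integrable_finsetSum _ fun k _ => hint i j k]
  refine Finset.sum_congr rfl fun i _ => ?_
  rw [integral_finsetSum _ fun j _ => integrable_finsetSum _ fun k _ => hint i j k]
  refine Finset.sum_congr rfl fun j _ => ?_
  rw [integral_finsetSum _ fun k _ => hint i j k]
  have h : ∀ k, ∫ ω, T ω i j * T ω i k * (v ω j * v ω k) ∂μ =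
      if j = k then s j * ∫ ω, T ω i j ^ 2 ∂μ else 0 := by
    intro k
    rw [(hind i j k).integral_fun_mul_eq_mul_integral (hTT i j k).1 (hvv j k).1, hcov]
    split_ifs with hjk
    · subst hjk; simp only [sq]; ring
    · simp
  simp [h]

/-- The hypotheses make the joint law a triple product, which is then reassociated. -/
lemma indepFun_prodMk_assoc {Ω A B C : Type*} [MeasurableSpace Ω] [MeasurableSpace A]
    [MeasurableSpace B] [MeasurableSpace C] {μ : Measure Ω} [IsProbabilityMeasure μ]
    {a : Ω → A} {b : Ω → B} {c : Ω → C} (ha : AEMeasurable a μ) (hb : AEMeasurable b μ)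
    (hc : AEMeasurable c μ) (h1 : IndepFun a (fun ω => (b ω, c ω)) μ) (h2 : IndepFun b c μ) :
    IndepFun (fun ω => (a ω, b ω)) c μ := by
  have hab : IndepFun a b μ := h1.comp (φ := id) (ψ := Prod.fst) measurable_id measurable_fst
  rw [indepFun_iff_map_prod_eq_prod_map_map (ha.prodMk hb) hc,
    (indepFun_iff_map_prod_eq_prod_map_map ha hb).1 hab]
  have e1 := (indepFun_iff_map_prod_eq_prod_map_map ha (hb.prodMk hc)).1 h1
  rw [(indepFun_iff_map_prod_eq_prod_map_map hb hc).1 h2] at e1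
  have : IsProbabilityMeasure (μ.map a) := Measure.isProbabilityMeasure_map ha
  have : IsProbabilityMeasure (μ.map b) := Measure.isProbabilityMeasure_map hb
  have : IsProbabilityMeasure (μ.map c) := Measure.isProbabilityMeasure_map hc
  have h3 := (measurePreserving_prodAssoc (μ.map a) (μ.map b) (μ.map c)).symm.map_eq
  rw [← e1, AEMeasurable.map_map_of_aemeasurable
    (MeasurableEquiv.measurable _).aemeasurable (ha.prodMk (hb.prodMk hc))] at h3
  rw [← h3]
  rfl

end RandomMatrixVector

/-! ### Exact finite-sample formulas for the estimator. -/

section SketchedRidge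

variable {m n p : ℕ}

/-- The sketched design as a function of the sketch and the design. -/
def sketchedDesign (u : (Fin m → Fin n → ℝ) × (Fin n → Fin p → ℝ)) : Fin m → Fin p → ℝ :=
  Matrix.of.symm (Matrix.of u.1 * Matrix.of u.2)

lemma primalSketchedRidge_eq (lam : ℝ) (L : Fin m → Fin n → ℝ) (X : Fin n → Fin p → ℝ)
    (Y : Fin n → ℝ) : primalSketchedRidge lam L X Y =
      noiseMatrix (1 / (n : ℝ)) lam (sketchedDesign (L, X)) X *ᵥ Y := by
  have e : (1 / (n : ℝ)) • ((Matrix.of X)ᵀ * (Matrix.of L)ᵀ * Matrix.of L * Matrix.of X) =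
      scaledGram (1 / (n : ℝ)) (sketchedDesign (L, X)) := by
    rw [scaledGram, sketchedDesign, Equiv.apply_symm_apply, Matrix.transpose_mul]
    simp only [Matrix.mul_assoc]
  rw [primalSketchedRidge, e, noiseMatrix, ridgeResolvent, Matrix.mulVec_smul, Matrix.smul_mulVec,
    Matrix.mulVec_mulVec]

lemma noiseMatrix_mul {ι κ : Type*} [Fintype ι] [Fintype κ] [DecidableEq κ] (c lam : ℝ)
    (Y : ι → κ → ℝ) (X : Fin n → κ → ℝ) :
    noiseMatrix c lam Y X * Matrix.of X = biasMatrix c lam Y X + 1 := by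
  rw [noiseMatrix, biasMatrix, Matrix.smul_mul, Matrix.mul_assoc, ← Matrix.mul_smul,
    sub_add_cancel]
  rfl

lemma sqBias_eq (lam : ℝ) (L : Fin m → Fin n → ℝ) (X : Fin n → Fin p → ℝ) (β : Fin p → ℝ) :
    sqBias lam L X β =
      sqNorm (biasMatrix (1 / (n : ℝ)) lam (sketchedDesign (L, X)) X *ᵥ β) := by
  rw [sqBias, primalSketchedRidge_eq, linearResponse, add_zero, Matrix.mulVec_mulVec,
    noiseMatrix_mul, Matrix.add_mulVec, Matrix.one_mulVec, add_sub_cancel_right]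

lemma sqDeviation_eq (lam : ℝ) (L : Fin m → Fin n → ℝ) (X : Fin n → Fin p → ℝ) (β : Fin p → ℝ)
    (ε : Fin n → ℝ) : sqDeviation lam L X β ε =
      sqNorm (noiseMatrix (1 / (n : ℝ)) lam (sketchedDesign (L, X)) X *ᵥ ε) := by
  rw [sqDeviation, primalSketchedRidge_eq, primalSketchedRidge_eq, ← Matrix.mulVec_sub,
    linearResponse, linearResponse, add_zero, add_sub_cancel_left]

/-- Stacking `β` and `ε` lets `integral_sqNorm_mulVec` remove the cross terms of the error. -/
lemma sqError_eq (lam : ℝ) (L : Fin m → Fin n → ℝ) (X : Fin n → Fin p → ℝ) (β : Fin p → ℝ)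
    (ε : Fin n → ℝ) : sqError lam L X β ε =
      sqNorm (Matrix.fromCols (biasMatrix (1 / (n : ℝ)) lam (sketchedDesign (L, X)) X)
        (noiseMatrix (1 / (n : ℝ)) lam (sketchedDesign (L, X)) X) *ᵥ Sum.elim β ε) := by
  rw [sqError, primalSketchedRidge_eq, linearResponse, Matrix.mulVec_add, Matrix.mulVec_mulVec,
    noiseMatrix_mul, Matrix.add_mulVec, Matrix.one_mulVec, Matrix.fromCols_mulVec_sumElim]
  congr 1
  abel

lemma measurable_biasMatrix_apply {Ω ι κ ν : Type*} [MeasurableSpace Ω] [Fintype ι] [Fintype κ]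
    [Fintype ν] [DecidableEq κ] {c lam : ℝ} {Y : Ω → ι → κ → ℝ} {X : Ω → ν → κ → ℝ}
    (hY : Measurable Y) (hX : Measurable X) (i j : κ) :
    Measurable fun ω => biasMatrix c lam (Y ω) (X ω) i j := by
  simp only [biasMatrix, Matrix.sub_apply, Matrix.mul_apply]
  exact (Finset.measurable_sum _ fun k _ => (measurable_ridgeResolvent
    (fun a b => measurable_scaledGram hY c a b) lam i k).mul
      (measurable_scaledGram hX c k j)).sub_const _

lemma measurable_noiseMatrix_apply {Ω ι κ ν : Type*} [MeasurableSpace Ω] [Fintype ι] [Fintype κ]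
    [Fintype ν] [DecidableEq κ] {c lam : ℝ} {Y : Ω → ι → κ → ℝ} {X : Ω → ν → κ → ℝ}
    (hY : Measurable Y) (hX : Measurable X) (i : κ) (j : ν) :
    Measurable fun ω => noiseMatrix c lam (Y ω) (X ω) i j := by
  simp only [noiseMatrix, Matrix.smul_apply, smul_eq_mul, Matrix.mul_apply,
    Matrix.transpose_apply, Matrix.of_apply]
  have h : ∀ k, Measurable fun ω => ridgeResolvent lam (scaledGram c (Y ω)) i k * X ω j k :=
    fun k => (measurable_ridgeResolvent (fun a b => measurable_scaledGram hY c a b) lam i k).mul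
      (by fun_prop)
  exact (Finset.measurable_sum Finset.univ fun k _ => h k).const_mul c

lemma measurable_sketchedDesign :
    Measurable (sketchedDesign : (Fin m → Fin n → ℝ) × (Fin n → Fin p → ℝ) → _) := by
  refine measurable_pi_iff.2 fun i => measurable_pi_iff.2 fun j => ?_
  simp only [sketchedDesign, Matrix.of_symm_apply, Matrix.mul_apply, Matrix.of_apply]
  fun_prop

/-- Needed to transfer the almost sure orthonormality of the sketch to its law. -/
lemma measurableSet_orthonormalRows :
    MeasurableSet {L : Fin m → Fin n → ℝ | Matrix.of L * (Matrix.of L)ᵀ = 1} := by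
  have : {L : Fin m → Fin n → ℝ | Matrix.of L * (Matrix.of L)ᵀ = 1} =
      ⋂ i, ⋂ j, {L : Fin m → Fin n → ℝ |
        ∑ a, L i a * L j a = (1 : Matrix (Fin m) (Fin m) ℝ) i j} := by
    ext L
    simp only [Set.mem_ofPred_eq, Set.mem_iInter, ← Matrix.ext_iff, Matrix.mul_apply,
      Matrix.transpose_apply, Matrix.of_apply]
  rw [this]
  refine MeasurableSet.iInter fun i => MeasurableSet.iInter fun j => ?_
  exact measurableSet_eq_fun (by fun_prop) measurable_const

/-- The expected squared Frobenius norms of the bias and noise matrices for a random sketch that is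
independent of the design. -/
lemma integral_prod_frobSq_sketch {N : ℕ} (hN : m + N = n) {c lam : ℝ} (hc : 0 ≤ c)
    (hlam : 0 < lam) (ν : Measure (Fin m → Fin n → ℝ)) [IsProbabilityMeasure ν]
    (hν : ∀ᵐ L ∂ν, Matrix.of L * (Matrix.of L)ᵀ = 1) :
    ∫ u, frobSq (biasMatrix c lam (sketchedDesign u) u.2)
        ∂(ν.prod (gaussianMat (Fin n) (Fin p))) =
      ((c * N - lam) ^ 2 + c ^ 2 * N * (p + 1)) * expFrobSq m (Fin p) c lam ∧
    ∫ u, frobSq (noiseMatrix c lam (sketchedDesign u) u.2)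
        ∂(ν.prod (gaussianMat (Fin n) (Fin p))) =
      c * (expTrace m (Fin p) c lam + (c * N - lam) * expFrobSq m (Fin p) c lam) := by
  have hX : ∀ (q : NNReal) (a : Fin n) (i : Fin p),
      MemLp (fun u : (Fin m → Fin n → ℝ) × (Fin n → Fin p → ℝ) => u.2 a i) q
        (ν.prod (gaussianMat (Fin n) (Fin p))) := fun q a i =>
    (memLp_eval_gaussianMat a i q).comp_measurePreserving measurePreserving_snd
  have hW : Measurable fun W : Fin m ⊕ Fin N → Fin p → ℝ => fun i => W (Sum.inl i) :=
    measurable_pi_iff.2 fun i => measurable_pi_apply _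
  constructor
  · rw [integral_prod _ (integrable_frobSq fun i j =>
      memLp_biasMatrix_apply hc hlam measurable_sketchedDesign (hX 4) i j)]
    have h : ∀ᵐ L ∂ν, ∫ X, frobSq (biasMatrix c lam (sketchedDesign (L, X)) X)
        ∂(gaussianMat (Fin n) (Fin p)) =
          ((c * N - lam) ^ 2 + c ^ 2 * N * (p + 1)) * expFrobSq m (Fin p) c lam := by
      -- -
      filter_upwards [hν] with L hL
      have h1 := integral_gaussianMat_sketch (κ := Fin p) hN L hL c
        (fun Y G => frobSq (ridgeResolvent lam (scaledGram c Y) * G - 1)) (by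
          exact Finset.measurable_sum _ fun i _ => Finset.measurable_sum _ fun j _ =>
            (measurable_biasMatrix_apply (c := c) (lam := lam) hW measurable_id i j).pow_const 2)
      have h2 := integral_prod_frobSq_biasMatrix (κ := Fin p) (ι' := Fin N) m hc hlam
      simp only [Fintype.card_fin] at h2
      exact h1.trans h2
    rw [integral_congr_ae h]
    simp
  · rw [integral_prod _ (integrable_frobSq fun i j =>
      memLp_noiseMatrix_apply hc hlam measurable_sketchedDesign (hX 2) i j)]
    have h : ∀ᵐ L ∂ν, ∫ X, frobSq (noiseMatrix c lam (sketchedDesign (L, X)) X)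
        ∂(gaussianMat (Fin n) (Fin p)) =
          c * (expTrace m (Fin p) c lam + (c * N - lam) * expFrobSq m (Fin p) c lam) := by
      filter_upwards [hν] with L hL
      have h1 := integral_gaussianMat_sketch (κ := Fin p) hN L hL c
        (fun Y G => c * (ridgeResolvent lam (scaledGram c Y) * G *
          (ridgeResolvent lam (scaledGram c Y))ᵀ).trace) (by
          simp only [← frobSq_noiseMatrix]
          exact Finset.measurable_sum _ fun i _ => Finset.measurable_sum _ fun j _ =>
            (measurable_noiseMatrix_apply (c := c) (lam := lam) hW measurable_id i j).pow_const 2)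
      have h2 := integral_prod_frobSq_noiseMatrix (κ := Fin p) (ι' := Fin N) m hc hlam
      simp only [Fintype.card_fin] at h2
      refine Eq.trans ?_ (h1.trans (Eq.trans ?_ h2))
      · simp only [frobSq_noiseMatrix]
        rfl
      · simp only [frobSq_noiseMatrix]
    rw [integral_congr_ae h]
    simp

/-- Exact expressions of the expected squared error, bias and deviation in terms of the resolvent
of a Gaussian Gram matrix. -/
lemma integral_sketchedRidge {N : ℕ} (hN : m + N = n) {lam sβ sε : ℝ} (hlam : 0 < lam)
    {Ω : Type*} [MeasurableSpace Ω] {P : Measure Ω} [IsProbabilityMeasure P]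
    {X : Ω → Fin n → Fin p → ℝ} {β : Ω → Fin p → ℝ} {ε : Ω → Fin n → ℝ}
    {L : Ω → Fin m → Fin n → ℝ}
    (hLm : AEMeasurable L P) (hLorth : ∀ᵐ ω ∂P, Matrix.of (L ω) * (Matrix.of (L ω))ᵀ = 1)
    (hXm : AEMeasurable X P) (hXlaw : P.map X = gaussianMat (Fin n) (Fin p))
    (hLX : IndepFun L X P)
    (hind : IndepFun (fun ω => (L ω, X ω)) (fun ω => (β ω, ε ω)) P)
    (hβ : ∀ i, MemLp (fun ω => β ω i) 2 P) (hε : ∀ i, MemLp (fun ω => ε ω i) 2 P)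
    (hββ : ∀ i j, ∫ ω, β ω i * β ω j ∂P = if i = j then sβ else 0)
    (hεε : ∀ i j, ∫ ω, ε ω i * ε ω j ∂P = if i = j then sε else 0)
    (hβε : ∀ i j, ∫ ω, β ω i * ε ω j ∂P = 0) :
    Integrable (fun ω => sqError lam (L ω) (X ω) (β ω) (ε ω)) P ∧
    Integrable (fun ω => sqBias lam (L ω) (X ω) (β ω)) P ∧
    Integrable (fun ω => sqDeviation lam (L ω) (X ω) (β ω) (ε ω)) P ∧
    ∫ ω, sqError lam (L ω) (X ω) (β ω) (ε ω) ∂P =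
      ∫ ω, sqBias lam (L ω) (X ω) (β ω) ∂P +
        ∫ ω, sqDeviation lam (L ω) (X ω) (β ω) (ε ω) ∂P ∧
    ∫ ω, sqBias lam (L ω) (X ω) (β ω) ∂P =
      sβ * (((1 / (n : ℝ) * N - lam) ^ 2 + (1 / (n : ℝ)) ^ 2 * N * (p + 1)) *
        expFrobSq m (Fin p) (1 / (n : ℝ)) lam) ∧
    ∫ ω, sqDeviation lam (L ω) (X ω) (β ω) (ε ω) ∂P =
      sε * (1 / (n : ℝ) * (expTrace m (Fin p) (1 / (n : ℝ)) lam +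
        (1 / (n : ℝ) * N - lam) * expFrobSq m (Fin p) (1 / (n : ℝ)) lam)) := by
  set c : ℝ := 1 / (n : ℝ) with hcdef
  have hc : 0 ≤ c := by positivity
  set U : Ω → (Fin m → Fin n → ℝ) × (Fin n → Fin p → ℝ) := fun ω => (L ω, X ω) with hU
  have hUm : AEMeasurable U P := hLm.prodMk hXm
  set ν := P.map L with hνdef
  have : IsProbabilityMeasure ν := Measure.isProbabilityMeasure_map hLm
  have hUlaw : P.map U = ν.prod (gaussianMat (Fin n) (Fin p)) := by
    rw [hU, (indepFun_iff_map_prod_eq_prod_map_map hLm hXm).1 hLX, hXlaw]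
  have hν : ∀ᵐ L ∂ν, Matrix.of L * (Matrix.of L)ᵀ = 1 :=
    (ae_map_iff hLm measurableSet_orthonormalRows).2 hLorth
  set B : (Fin m → Fin n → ℝ) × (Fin n → Fin p → ℝ) → Matrix (Fin p) (Fin p) ℝ := fun u =>
    biasMatrix c lam (sketchedDesign u) u.2 with hB
  set K : (Fin m → Fin n → ℝ) × (Fin n → Fin p → ℝ) → Matrix (Fin p) (Fin n) ℝ := fun u =>
    noiseMatrix c lam (sketchedDesign u) u.2 with hK
  have hX : ∀ (q : NNReal) (a : Fin n) (i : Fin p),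
      MemLp (fun u : (Fin m → Fin n → ℝ) × (Fin n → Fin p → ℝ) => u.2 a i) q
        (ν.prod (gaussianMat (Fin n) (Fin p))) := fun q a i =>
    (memLp_eval_gaussianMat a i q).comp_measurePreserving measurePreserving_snd
  have hBm : ∀ i j, Measurable fun u => B u i j := fun i j =>
    measurable_biasMatrix_apply measurable_sketchedDesign measurable_snd i j
  have hKm : ∀ i j, Measurable fun u => K u i j := fun i j =>
    measurable_noiseMatrix_apply measurable_sketchedDesign measurable_snd i j
  have hBL : ∀ i j, MemLp (fun u => B u i j) 2 (P.map U) := fun i j => by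
    rw [hUlaw]; exact memLp_biasMatrix_apply hc hlam measurable_sketchedDesign (hX 4) i j
  have hKL : ∀ i j, MemLp (fun u => K u i j) 2 (P.map U) := fun i j => by
    rw [hUlaw]; exact memLp_noiseMatrix_apply hc hlam measurable_sketchedDesign (hX 2) i j
  have hBΩ : ∀ i j, MemLp (fun ω => B (U ω) i j) 2 P := fun i j => (hBL i j).comp_of_map hUm
  have hKΩ : ∀ i j, MemLp (fun ω => K (U ω) i j) 2 P := fun i j => (hKL i j).comp_of_map hUm
  have sumB : ∑ i, ∑ j, ∫ ω, B (U ω) i j ^ 2 ∂P =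
      ((c * N - lam) ^ 2 + c ^ 2 * N * (p + 1)) * expFrobSq m (Fin p) c lam := by
    rw [← (integral_prod_frobSq_sketch hN hc hlam ν hν).1, ← hUlaw]
    simp only [frobSq]
    rw [integral_finsetSum _ fun i _ => integrable_finsetSum _ fun j _ => (hBL i j).integrable_sq]
    refine Finset.sum_congr rfl fun i _ => ?_
    rw [integral_finsetSum _ fun j _ => (hBL i j).integrable_sq]
    exact Finset.sum_congr rfl fun j _ => (integral_map hUm ((hBL i j).1.pow 2)).symm
  have sumK : ∑ i, ∑ j, ∫ ω, K (U ω) i j ^ 2 ∂P =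
      c * (expTrace m (Fin p) c lam + (c * N - lam) * expFrobSq m (Fin p) c lam) := by
    rw [← (integral_prod_frobSq_sketch hN hc hlam ν hν).2, ← hUlaw]
    simp only [frobSq]
    rw [integral_finsetSum _ fun i _ => integrable_finsetSum _ fun j _ => (hKL i j).integrable_sq]
    refine Finset.sum_congr rfl fun i _ => ?_
    rw [integral_finsetSum _ fun j _ => (hKL i j).integrable_sq]
    exact Finset.sum_congr rfl fun j _ => (integral_map hUm ((hKL i j).1.pow 2)).symm
  obtain ⟨bi, be⟩ := integral_sqNorm_mulVec (T := fun ω => B (U ω)) (v := β) (s := fun _ => sβ)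
    hBΩ hβ (fun i j k => hind.comp (φ := fun u => B u i j * B u i k)
      (ψ := fun q : (Fin p → ℝ) × (Fin n → ℝ) => q.1 j * q.1 k)
      ((hBm i j).mul (hBm i k)) (by fun_prop)) hββ
  obtain ⟨di, de⟩ := integral_sqNorm_mulVec (T := fun ω => K (U ω)) (v := ε) (s := fun _ => sε)
    hKΩ hε (fun i j k => hind.comp (φ := fun u => K u i j * K u i k)
      (ψ := fun q : (Fin p → ℝ) × (Fin n → ℝ) => q.2 j * q.2 k)
      ((hKm i j).mul (hKm i k)) (by fun_prop)) hεε
  have hCm : ∀ i j, Measurable fun u => Matrix.fromCols (B u) (K u) i j := by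
    rintro i (j | j)
    · exact hBm i j
    · exact hKm i j
  have hvm : ∀ j, Measurable fun q : (Fin p → ℝ) × (Fin n → ℝ) => Sum.elim q.1 q.2 j := by
    rintro (j | j)
    · exact (measurable_pi_apply j).comp measurable_fst
    · exact (measurable_pi_apply j).comp measurable_snd
  obtain ⟨ei, ee⟩ := integral_sqNorm_mulVec (T := fun ω => Matrix.fromCols (B (U ω)) (K (U ω)))
    (v := fun ω => Sum.elim (β ω) (ε ω)) (s := Sum.elim (fun _ => sβ) (fun _ => sε)) (μ := P)
    (by
      rintro i (j | j)
      · exact hBΩ i j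
      · exact hKΩ i j)
    (by
      rintro (j | j)
      · exact hβ j
      · exact hε j)
    (fun i j k => hind.comp
      (φ := fun u => Matrix.fromCols (B u) (K u) i j * Matrix.fromCols (B u) (K u) i k)
      (ψ := fun q : (Fin p → ℝ) × (Fin n → ℝ) => Sum.elim q.1 q.2 j * Sum.elim q.1 q.2 k)
      ((hCm i j).mul (hCm i k)) ((hvm j).mul (hvm k)))
    (by
      rintro (j | j) (k | k)
      · simpa using hββ j k
      · simpa using hβε j k
      · simpa [mul_comm] using hβε k j
      · simpa using hεε j k)
  simp only [Fintype.sum_sum_type, Sum.elim_inl, Sum.elim_inr, Matrix.fromCols_apply_inl,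
    Matrix.fromCols_apply_inr, Finset.sum_add_distrib] at ee
  rw [← be, ← de] at ee
  simp only [← Finset.mul_sum] at be de
  rw [sumB] at be
  rw [sumK] at de
  have f1 : ∀ ω, sqBias lam (L ω) (X ω) (β ω) = sqNorm (B (U ω) *ᵥ β ω) := fun ω =>
    sqBias_eq _ _ _ _
  have f2 : ∀ ω, sqDeviation lam (L ω) (X ω) (β ω) (ε ω) = sqNorm (K (U ω) *ᵥ ε ω) := fun ω =>
    sqDeviation_eq _ _ _ _ _
  have f3 : ∀ ω, sqError lam (L ω) (X ω) (β ω) (ε ω) =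
      sqNorm (Matrix.fromCols (B (U ω)) (K (U ω)) *ᵥ Sum.elim (β ω) (ε ω)) := fun ω =>
    sqError_eq _ _ _ _ _
  simp only [f1, f2, f3]
  exact ⟨ei, bi, di, ee, be, de⟩

end SketchedRidge

lemma map_eq_gaussianMat {Ω : Type*} [MeasurableSpace Ω] {P : Measure Ω} [IsProbabilityMeasure P]
    {n p : ℕ} {X : Ω → Fin n → Fin p → ℝ}
    (hlaw : ∀ i j, HasLaw (fun ω => X ω i j) (gaussianReal 0 1) P)
    (hindep : iIndepFun (fun (ij : Fin n × Fin p) (ω : Ω) => X ω ij.1 ij.2) P) :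
    P.map X = gaussianMat (Fin n) (Fin p) := by
  have hm : ∀ ij : Fin n × Fin p, AEMeasurable (fun ω => X ω ij.1 ij.2) P :=
    fun ij => (hlaw ij.1 ij.2).aemeasurable
  have h := (iIndepFun_iff_map_fun_eq_pi_map hm).1 hindep
  simp only [(hlaw _ _).map_eq] at h
  have h2 := (measurePreserving_curry_gaussianMat (ι := Fin n) (κ := Fin p)).map_eq
  rw [← h, AEMeasurable.map_map_of_aemeasurable (MeasurableEquiv.measurable _).aemeasurable
    (aemeasurable_pi_lambda _ hm)] at h2
  exact h2

end

theorem theorem3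
    -- the dimensions and their proportional limits
    (n p m : ℕ → ℕ) (γ ξ α σ lam : ℝ)
    (hγ : 0 < γ) (hξ0 : 0 < ξ) (hξ1 : ξ < 1) (hlam : 0 < lam)
    (hn : Tendsto n atTop atTop) (hp : Tendsto p atTop atTop) (hm : Tendsto m atTop atTop)
    (hpn : Tendsto (fun k => (p k : ℝ) / (n k : ℝ)) atTop (𝓝 γ))
    (hmn : Tendsto (fun k => (m k : ℝ) / (n k : ℝ)) atTop (𝓝 ξ))
    (hmltn : ∀ k, m k < n k)
    -- for each `k`, a probability space with the data `X`, coefficients `β`, noise `ε`, sketch `L`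
    (Ω : ℕ → Type*) [∀ k, MeasurableSpace (Ω k)]
    (P : ∀ k, Measure (Ω k)) [∀ k, IsProbabilityMeasure (P k)]
    (X : ∀ k, Ω k → Fin (n k) → Fin (p k) → ℝ)
    (β : ∀ k, Ω k → Fin (p k) → ℝ)
    (ε : ∀ k, Ω k → Fin (n k) → ℝ)
    (L : ∀ k, Ω k → Fin (m k) → Fin (n k) → ℝ)
    -- `X` has iid standard normal entries
    (hXlaw : ∀ k i j, HasLaw (fun ω => X k ω i j) (gaussianReal 0 1) (P k))
    (hXindep : ∀ k, iIndepFun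
      (fun (ij : Fin (n k) × Fin (p k)) (ω : Ω k) => X k ω ij.1 ij.2) (P k))
    -- `β` has iid entries with mean zero and variance `α² / p`
    (hβL2 : ∀ k i, MemLp (fun ω => β k ω i) 2 (P k))
    (hβindep : ∀ k, iIndepFun (fun (i : Fin (p k)) (ω : Ω k) => β k ω i) (P k))
    (hβident : ∀ k i j, IdentDistrib (fun ω => β k ω i) (fun ω => β k ω j) (P k) (P k))
    (hβmean : ∀ k i, ∫ ω, β k ω i ∂(P k) = 0)
    (hβvar : ∀ k i, variance (fun ω => β k ω i) (P k) = α ^ 2 / (p k : ℝ))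
    -- the noise has mean zero and covariance `σ² I_n`
    (hεL2 : ∀ k i, MemLp (fun ω => ε k ω i) 2 (P k))
    (hεmean : ∀ k i, ∫ ω, ε k ω i ∂(P k) = 0)
    (hεcov : ∀ k i j, covariance (fun ω => ε k ω i) (fun ω => ε k ω j) (P k) =
      if i = j then σ ^ 2 else 0)
    -- `L` is a (possibly random) matrix with orthonormal rows
    (hLmeas : ∀ k, AEMeasurable (L k) (P k))
    (hLorth : ∀ k, ∀ᵐ ω ∂(P k), Matrix.of (L k ω) * (Matrix.of (L k ω))ᵀ = 1)
    -- the noise is independent of `X`, `β` of `X` and the noise, and the sketch of all the data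
    (hXε : ∀ k, IndepFun (ε k) (X k) (P k))
    (hβXε : ∀ k, IndepFun (β k) (fun ω => (X k ω, ε k ω)) (P k))
    (hLXεβ : ∀ k, IndepFun (L k) (fun ω => (X k ω, ε k ω, β k ω)) (P k)) :
    -- the squared error, squared bias and squared deviation have finite expectations
    (∀ k, Integrable (fun ω => sqError lam (L k ω) (X k ω) (β k ω) (ε k ω)) (P k)) ∧
    (∀ k, Integrable (fun ω => sqBias lam (L k ω) (X k ω) (β k ω)) (P k)) ∧
    (∀ k, Integrable (fun ω => sqDeviation lam (L k ω) (X k ω) (β k ω) (ε k ω)) (P k)) ∧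
    -- limit of the MSE, and of its squared bias and variance parts
    Tendsto (fun k => ∫ ω, sqError lam (L k ω) (X k ω) (β k ω) (ε k ω) ∂(P k)) atTop
      (𝓝 (limitSqBias α lam γ ξ + limitVariance σ lam γ ξ)) ∧
    Tendsto (fun k => ∫ ω, sqBias lam (L k ω) (X k ω) (β k ω) ∂(P k)) atTop
      (𝓝 (limitSqBias α lam γ ξ)) ∧
    Tendsto (fun k => ∫ ω, sqDeviation lam (L k ω) (X k ω) (β k ω) (ε k ω) ∂(P k)) atTop
      (𝓝 (limitVariance σ lam γ ξ)) := by
  have hXm : ∀ k, AEMeasurable (X k) (P k) := fun k =>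
    aemeasurable_pi_lambda _ fun i => aemeasurable_pi_lambda _ fun j => (hXlaw k i j).aemeasurable
  have hβm : ∀ k, AEMeasurable (β k) (P k) := fun k =>
    aemeasurable_pi_lambda _ fun i => (hβL2 k i).1.aemeasurable
  have hεm : ∀ k, AEMeasurable (ε k) (P k) := fun k =>
    aemeasurable_pi_lambda _ fun i => (hεL2 k i).1.aemeasurable
  have hββ : ∀ k i j, ∫ ω, β k ω i * β k ω j ∂(P k) =
      if i = j then α ^ 2 / (p k : ℝ) else 0 := by
    intro k i j
    split_ifs with hij
    · subst hij
      have h := hβvar k i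
      rw [variance_eq_sub (hβL2 k i), hβmean k i] at h
      simpa [sq] using h
    · have h := ((hβindep k).indepFun hij).integral_fun_mul_eq_mul_integral (hβL2 k i).1
        (hβL2 k j).1
      rw [h, hβmean k i, zero_mul]
  have hεε : ∀ k i j, ∫ ω, ε k ω i * ε k ω j ∂(P k) = if i = j then σ ^ 2 else 0 := by
    intro k i j
    rw [← hεcov k i j, covariance_eq_sub (hεL2 k i) (hεL2 k j), hεmean k i]
    simp
  have hβε : ∀ k i j, ∫ ω, β k ω i * ε k ω j ∂(P k) = 0 := by
    intro k i j
    have h : IndepFun (fun ω => β k ω i) (fun ω => ε k ω j) (P k) := by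
      have hφ : Measurable fun b : Fin (p k) → ℝ => b i := by fun_prop
      have hψ : Measurable fun q : (Fin (n k) → Fin (p k) → ℝ) × (Fin (n k) → ℝ) => q.2 j := by
        fun_prop
      exact (hβXε k).comp hφ hψ
    have h2 := h.integral_fun_mul_eq_mul_integral (hβL2 k i).1 (hεL2 k j).1
    rw [h2, hβmean k i, zero_mul]
  have hLX : ∀ k, IndepFun (L k) (X k) (P k) := fun k =>
    (hLXεβ k).comp (φ := id) (ψ := Prod.fst) measurable_id measurable_fst
  have hXβε : ∀ k, IndepFun (X k) (fun ω => (β k ω, ε k ω)) (P k) := fun k =>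
    (indepFun_prodMk_assoc (hβm k) (hεm k) (hXm k)
      ((hβXε k).comp (φ := id) (ψ := Prod.swap) measurable_id measurable_swap) (hXε k)).symm
  have hind : ∀ k, IndepFun (fun ω => (L k ω, X k ω)) (fun ω => (β k ω, ε k ω)) (P k) := fun k =>
    indepFun_prodMk_assoc (hLmeas k) (hXm k) ((hβm k).prodMk (hεm k))
      ((hLXεβ k).comp (φ := id)
        (ψ := fun q : (Fin (n k) → Fin (p k) → ℝ) × (Fin (n k) → ℝ) × (Fin (p k) → ℝ) =>
          (q.1, (q.2.2, q.2.1))) measurable_id (by fun_prop)) (hXβε k)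
  have hN : ∀ k, m k + (n k - m k) = n k := fun k => Nat.add_sub_cancel' (hmltn k).le
  have main := fun k => integral_sketchedRidge (hN k) hlam (hLmeas k) (hLorth k) (hXm k)
    (map_eq_gaussianMat (hXlaw k) (hXindep k)) (hLX k) (hind k) (hβL2 k) (hεL2 k) (hββ k) (hεε k)
    (hβε k)
  have hn' : Tendsto (fun k => (n k : ℝ)) atTop atTop := tendsto_natCast_atTop_atTop.comp hn
  have hNn : Tendsto (fun k => 1 / (n k : ℝ) * ((n k - m k : ℕ) : ℝ)) atTop (𝓝 (1 - ξ)) := by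
    refine (hmn.const_sub 1).congr' ?_
    filter_upwards [hn'.eventually_gt_atTop 0] with k hk
    rw [Nat.cast_sub (hmltn k).le]
    field_simp
  have h1n : Tendsto (fun k => 1 / (n k : ℝ)) atTop (𝓝 0) :=
    tendsto_const_nhds.div_atTop hn'
  have hT := tendsto_expTrace_div hγ hξ0 hlam hn hpn hmn
  have hF := tendsto_expFrobSq_div hγ hξ0 hlam hn hp hpn hmn
  have hp0 : ∀ᶠ k in atTop, (p k : ℝ) ≠ 0 := by
    filter_upwards [hp.eventually_gt_atTop 0] with k hk
    exact_mod_cast hk.ne'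
  have hbias : Tendsto (fun k => ∫ ω, sqBias lam (L k ω) (X k ω) (β k ω) ∂(P k)) atTop
      (𝓝 (limitSqBias α lam γ ξ)) := by
    have h := ((((hNn.sub_const lam).pow 2).add (hNn.mul (hpn.add h1n))).mul hF).const_mul (α ^ 2)
    have e : α ^ 2 * (((1 - ξ - lam) ^ 2 + (1 - ξ) * (γ + 0)) *
        (mpTheta 2 (γ / ξ) (lam / ξ) / ξ ^ 2)) = limitSqBias α lam γ ξ := by
      rw [limitSqBias]; ring
    rw [e] at h
    refine h.congr fun k => ?_
    rw [(main k).2.2.2.2.1]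
    ring
  have hvar : Tendsto (fun k => ∫ ω, sqDeviation lam (L k ω) (X k ω) (β k ω) (ε k ω) ∂(P k)) atTop
      (𝓝 (limitVariance σ lam γ ξ)) := by
    have h := (hpn.mul (hT.add ((hNn.sub_const lam).mul hF))).const_mul (σ ^ 2)
    have e : σ ^ 2 * (γ * (mpTheta 1 (γ / ξ) (lam / ξ) / ξ +
        (1 - ξ - lam) * (mpTheta 2 (γ / ξ) (lam / ξ) / ξ ^ 2))) = limitVariance σ lam γ ξ := by
      rw [limitVariance]; field_simp; ring
    rw [e] at h
    refine h.congr' ?_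
    filter_upwards [hp0] with k hk
    rw [(main k).2.2.2.2.2]
    field_simp
  refine ⟨fun k => (main k).1, fun k => (main k).2.1, fun k => (main k).2.2.1, ?_, hbias, hvar⟩
  exact (hbias.add hvar).congr fun k => (main k).2.2.2.1.symm
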